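/- Let $\mathbf k$ be a field and let $\mathcal C$ be a triangulated persistence category (TPC) over $\mathbf k$. That is: * every $\hom_{\mathcal C}(A,B)$ is a persistence $\mathbf k$-module $(\hom^r(A,B))_{r\in\mathbb R}$ with structure maps $i_{r,s}$ ($r\le s$), composition $\hom^r(A,B)\times\hom^s(B,C)\to\hom^{r+s}(A,C)$ is bilinear and natural in $r,s$, and $\mathbb 1_A\in\hom^0(A,A)$; * there is a shift functor, i.e. persistence endofunctors $\Sigma^r$ ($r\in\mathbb R$) and natural transformations $\eta_{r,s}:\Sigma^r\to\Sigma^s$ of shift $s-r$ forming a strict monoidal functor on $(\mathbb R,+)$ (with exactly one morphism $r\to s$ for all $r,s$); for $r\ge 0$ put $\eta^A_r=i_{-r,0}((\eta_{r,0})_A)\in\hom^0(\Sigma^rA,A)$; * the $0$-level $\mathcal C_0$ (same objects, morphisms $\hom^0$) is triangulated with translation $T$; each $\Sigma^r$ commutes with $T$ and preserves exact triangles, $T\eta_r^A=\eta_r^{TA}$, and for all $r\ge0$ the map $\eta_r^A$ embeds in an exact triangle $\Sigma^rA\to A\to K\to T\Sigma^rA$ of $\mathcal C_0$ with $K$ $r$-acyclic,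 meaning $i_{0,r}(\mathbb 1_K)=0$. Let $\mathcal C_\infty$ be the limit category (same objects, $\hom_{\mathcal C_\infty}(A,B)=\varinjlim_r\hom^r(A,B)$); its exact triangles are those isomorphic in $\mathcal C_\infty$ to images of exact triangles of $\mathcal C_0$. An $r$-isomorphism is a morphism of $\mathcal C_0$ whose cone is $r$-acyclic. A diagram $A\xrightarrow{\bar u}B\xrightarrow{\bar v}C\xrightarrow{\bar w}\Sigma^{-r}TA$ in $\mathcal C_0$ is strict exact of weight $r\ge0$ if there are an exact triangle $A\xrightarrow{\bar u}B\xrightarrow{v}C'\xrightarrow{w}TA$ in $\mathcal C_0$, an $r$-isomorphism $\phi:C'\to C$ and a morphism $\psi:\Sigma^rC\to C'$ of $\mathcal C_0$ with $\phi\psi=\eta_r^C$, $\bar v=\phi v$ and $w\psi=\Sigma^r\bar w$. The unstable weight $w_\infty(\Delta)$ of an exact triangle $\Delta:A\to B\to C\to TA$ of $\mathcal C_\infty$ is the infimum of the weights $r$ of the strict exact triangles $A\to\Sigma^{-q}B\to\Sigma^{-s}C\to\Sigma^{-r}TA$, $0\le q\le s\le r$, that represent $\Delta$ (via the isomorphisms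 $\eta_{-q,0},\eta_{-s,0},\eta_{-r,0}$), and the persistence weight is $\bar w(\Delta)=\inf_{s\ge0}w_\infty(\Sigma^{s,0,0,s}\Delta)$, where $\Sigma^{s,0,0,s}\Delta$ is the triangle $\Sigma^sA\to B\to C\to T\Sigma^sA$ obtained from $\Delta$ by composing with $(\eta_{s,0})_A$ and $(\eta_{0,s})_{TA}$. For a family $\mathcal F$ of objects with $0\in\mathcal F$, let $\bar\delta^{\mathcal F}(X,X')\in[0,\infty]$ be the infimum of $\sum_{i=1}^n\bar w(\Delta_i)$ over all sequences of exact triangles $\Delta_i:X_i\to Y_{i-1}\to Y_i\to TX_i$ of $\mathcal C_\infty$ ($1\le i\le n$) with $Y_0=0$, $Y_n=X$ and, for some $j$, $X_j=T^{-1}X'$ and $X_i\in\mathcal F$ for all $i\ne j$. Put $$\widehat{\delta^{\mathcal F}}(X,Y)=\inf_{r,s\in\mathbb R}\bar\delta^{\mathcal F}(\Sigma^rX,\Sigma^sY),\qquad \widehat{d^{\mathcal F}}(X,Y)=\max\{\widehat{\delta^{\mathcal F}}(X,Y),\widehat{\delta^{\mathcal F}}(Y,X)\}.$$ Let $d_{int}(X,Y)\in[0,\infty]$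 be the infimum of all $r\ge0$ for which there are $\phi\in\hom_{\mathcal C_0}(\Sigma^rX,Y)$ and $\psi\in\hom_{\mathcal C_0}(\Sigma^rY,X)$ with $\psi\circ\Sigma^r\phi=\eta^X_{2r}$ and $\phi\circ\Sigma^r\psi=\eta^Y_{2r}$, and put $\widehat{d_{int}}(X,Y)=\inf_{r\in\mathbb R}d_{int}(\Sigma^rX,Y)$. (An infimum over the empty set is $+\infty$.) Then for all objects $X,Y$ of $\mathcal C$, $$\tfrac12\,\widehat{d_{int}}(X,Y)\ \le\ \widehat{d^{\{0\}}}(X,Y)\ \le\ 4\,\widehat{d_{int}}(X,Y).$$ In particular, for every family $\mathcal F$ of objects with $0\in\mathcal F$, $\ \widehat{d^{\mathcal F}}(X,Y)\le 4\,\widehat{d_{int}}(X,Y)$ for all $X,Y$. -/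

import Mathlib

open CategoryTheory CategoryTheory.Limits CategoryTheory.Pretriangulated
open scoped ENNReal

universe w v u

/-- A persistence category over the field `k`: every `Hom A B` is a persistence `k`-module
(a functor from `(ℝ, ≤)` to `k`-vector spaces, with values `Hom A B r` and structure maps `pmap`),
and the composition `Hom A B r × Hom B C s → Hom A C (r + s)`, written in diagrammatic order,
is bilinear and natural in the persistence parameters. For `r = s` the map `pmap` is the canonical
identification of `Hom A B r` with `Hom A B s`; it is used in the unit and associativity laws. -/
structure PersCat (k : Type w) [Field k] where
  Obj : Type u
  Hom : Obj → Obj → ℝ → Type v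
  [addCommGroup : ∀ A B r, AddCommGroup (Hom A B r)]
  [module : ∀ A B r, Module k (Hom A B r)]
  pmap : ∀ {A B : Obj} {r s : ℝ}, r ≤ s → (Hom A B r →ₗ[k] Hom A B s)
  pmap_refl : ∀ {A B : Obj} {r : ℝ} (f : Hom A B r), pmap (le_refl r) f = f
  pmap_pmap : ∀ {A B : Obj} {r s t : ℝ} (h : r ≤ s) (h' : s ≤ t) (f : Hom A B r),
    pmap h' (pmap h f) = pmap (h.trans h') f
  one : ∀ A : Obj, Hom A A 0
  comp : ∀ {A B C : Obj} {r s : ℝ}, Hom A B r →ₗ[k] Hom B C s →ₗ[k] Hom A C (r + s)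
  pmap_comp : ∀ {A B C : Obj} {r s r' s' : ℝ} (h : r ≤ r') (h' : s ≤ s')
    (f : Hom A B r) (g : Hom B C s),
    comp (pmap h f) (pmap h' g) = pmap (add_le_add h h') (comp f g)
  one_comp : ∀ {A B : Obj} {r : ℝ} (f : Hom A B r),
    pmap (zero_add r).le (comp (one A) f) = f
  comp_one : ∀ {A B : Obj} {r : ℝ} (f : Hom A B r),
    pmap (add_zero r).le (comp f (one B)) = f
  assoc : ∀ {A B C D : Obj} {r s t : ℝ} (f : Hom A B r) (g : Hom B C s) (h : Hom C D t),
    pmap (add_assoc r s t).le (comp (comp f g) h) = comp f (comp g h)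

namespace PersCat

attribute [instance] PersCat.addCommGroup PersCat.module

variable {k : Type w} [Field k] (𝒞 : PersCat.{w, v, u} k)

/-- Composition followed by the persistence map to a level `t ≥ r + s`
(for `t = r + s` this is just the composition). -/
def compTo {A B C : 𝒞.Obj} {r s t : ℝ} (h : r + s ≤ t) (f : 𝒞.Hom A B r) (g : 𝒞.Hom B C s) :
    𝒞.Hom A C t :=
  𝒞.pmap h (𝒞.comp f g)

theorem compTo_pmap {A B C : 𝒞.Obj} {r s r' s' t : ℝ} (h : r ≤ r') (h' : s ≤ s')
    (ht : r' + s' ≤ t) (f : 𝒞.Hom A B r) (g : 𝒞.Hom B C s) :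
    𝒞.compTo ht (𝒞.pmap h f) (𝒞.pmap h' g) =
      𝒞.compTo ((add_le_add h h').trans ht) f g := by
  unfold compTo
  rw [𝒞.pmap_comp, 𝒞.pmap_pmap]

theorem pmap_compTo {A B C : 𝒞.Obj} {r s t t' : ℝ} (h : r + s ≤ t) (ht : t ≤ t')
    (f : 𝒞.Hom A B r) (g : 𝒞.Hom B C s) :
    𝒞.pmap ht (𝒞.compTo h f g) = 𝒞.compTo (h.trans ht) f g := by
  unfold compTo
  rw [𝒞.pmap_pmap]

theorem compTo_assoc {A B C D : 𝒞.Obj} {r s t x y z : ℝ} (f : 𝒞.Hom A B r) (g : 𝒞.Hom B C s)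
    (h : 𝒞.Hom C D t) (hx : r + s ≤ x) (hxz : x + t ≤ z) (hy : s + t ≤ y) (hyz : r + y ≤ z) :
    𝒞.compTo hxz (𝒞.compTo hx f g) h = 𝒞.compTo hyz f (𝒞.compTo hy g h) := by
  have h1 := 𝒞.pmap_comp hx (le_refl t) (𝒞.comp f g) h
  have h2 := 𝒞.pmap_comp (le_refl r) hy f (𝒞.comp g h)
  rw [𝒞.pmap_refl] at h1 h2
  unfold compTo
  rw [h1, h2, 𝒞.pmap_pmap, 𝒞.pmap_pmap, ← 𝒞.assoc, 𝒞.pmap_pmap]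

theorem one_compTo {A B : 𝒞.Obj} {r t : ℝ} (h : 0 + r ≤ t) (f : 𝒞.Hom A B r) :
    𝒞.compTo h (𝒞.one A) f = 𝒞.pmap ((zero_add r).symm.le.trans h) f := by
  conv_rhs => rw [← 𝒞.one_comp f]
  rw [𝒞.pmap_pmap]; rfl

theorem compTo_one {A B : 𝒞.Obj} {r t : ℝ} (h : r + 0 ≤ t) (f : 𝒞.Hom A B r) :
    𝒞.compTo h f (𝒞.one B) = 𝒞.pmap ((add_zero r).symm.le.trans h) f := by
  conv_rhs => rw [← 𝒞.comp_one f]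
  rw [𝒞.pmap_pmap]; rfl

theorem add_compTo {A B C : 𝒞.Obj} {r s t : ℝ} (h : r + s ≤ t) (f f' : 𝒞.Hom A B r)
    (g : 𝒞.Hom B C s) : 𝒞.compTo h (f + f') g = 𝒞.compTo h f g + 𝒞.compTo h f' g := by
  simp [compTo]

theorem compTo_add {A B C : 𝒞.Obj} {r s t : ℝ} (h : r + s ≤ t) (f : 𝒞.Hom A B r)
    (g g' : 𝒞.Hom B C s) : 𝒞.compTo h f (g + g') = 𝒞.compTo h f g + 𝒞.compTo h f g' := by
  simp [compTo]

/-- The identity of `A`, viewed as a morphism `A → B` when `A = B`. -/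
def ofEq {A B : 𝒞.Obj} (h : A = B) : 𝒞.Hom A B 0 := h ▸ 𝒞.one A

/-! ### The `0`-level -/

/-- The `0`-level category `𝒞₀`: same objects as `𝒞`, morphisms of shift `0`. The arrow `A ⟶ B`
between objects of `𝒞` always denotes a morphism of `𝒞₀`. -/
instance zeroCategory : Category.{v} 𝒞.Obj where
  Hom A B := 𝒞.Hom A B 0
  id A := 𝒞.one A
  comp f g := 𝒞.compTo (add_zero (0 : ℝ)).le f g
  id_comp f := by rw [𝒞.one_compTo, 𝒞.pmap_refl]
  comp_id f := by rw [𝒞.compTo_one, 𝒞.pmap_refl]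
  assoc f g h := 𝒞.compTo_assoc f g h _ _ _ _

instance zeroPreadditive : Preadditive 𝒞.Obj where
  homGroup A B := 𝒞.addCommGroup A B 0
  add_comp _ _ _ f f' g := 𝒞.add_compTo (add_zero (0 : ℝ)).le f f' g
  comp_add _ _ _ f g g' := 𝒞.compTo_add (add_zero (0 : ℝ)).le f g g'

/-- `K` is `r`-acyclic: its identity becomes `0` after applying the persistence map `0 ≤ r`. -/
def IsAcyclic (r : ℝ) (hr : 0 ≤ r) (K : 𝒞.Obj) : Prop :=
  𝒞.pmap hr (𝒞.one K) = 0

/-! ### The limit category -/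

/-- `∞`-equivalence of morphisms (of possibly different shifts) from `A` to `B`. -/
def infSetoid (A B : 𝒞.Obj) : Setoid (Σ r : ℝ, 𝒞.Hom A B r) where
  r f g := ∃ (t : ℝ) (hf : f.1 ≤ t) (hg : g.1 ≤ t), 𝒞.pmap hf f.2 = 𝒞.pmap hg g.2
  iseqv :=
    { refl := fun f => ⟨f.1, le_refl _, le_refl _, rfl⟩
      symm := fun ⟨t, hf, hg, h⟩ => ⟨t, hg, hf, h.symm⟩
      trans := by
        rintro f g e ⟨t, hf, hg, h⟩ ⟨t', hg', he, h'⟩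
        refine ⟨max t t', hf.trans (le_max_left _ _), he.trans (le_max_right _ _), ?_⟩
        rw [← 𝒞.pmap_pmap hf (le_max_left t t'), h, 𝒞.pmap_pmap,
          ← 𝒞.pmap_pmap he (le_max_right t t'), ← h', 𝒞.pmap_pmap] }

/-- The objects of the limit category `𝒞_∞`: `𝒞.inf A` is the object `A` of `𝒞`, viewed as an
object of `𝒞_∞`. -/
structure Inf where
  obj : 𝒞.Obj

/-- The object `A` of `𝒞`, viewed as an object of `𝒞_∞`. -/
abbrev inf (A : 𝒞.Obj) : 𝒞.Inf := ⟨A⟩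

/-- The limit category `𝒞_∞`: same objects, and the morphisms `A ⟶ B` are the elements of the
direct limit of the `Hom A B r` as `r → ∞`. -/
instance infCategory : Category.{v} 𝒞.Inf where
  Hom A B := Quotient (𝒞.infSetoid A.obj B.obj)
  id A := Quotient.mk (𝒞.infSetoid A.obj A.obj) ⟨0, 𝒞.one A.obj⟩
  comp {A B C} := Quotient.map₂ (sc := 𝒞.infSetoid A.obj C.obj)
    (fun f g => ⟨f.1 + g.1, 𝒞.comp f.2 g.2⟩) (by
      rintro f f' ⟨t, hf, hf', h⟩ g g' ⟨s, hg, hg', h'⟩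
      refine ⟨t + s, add_le_add hf hg, add_le_add hf' hg', ?_⟩
      dsimp only
      rw [← 𝒞.pmap_comp hf hg, ← 𝒞.pmap_comp hf' hg', h, h'])
  id_comp := by
    rintro A B ⟨f⟩
    refine Quotient.sound ⟨f.1, (zero_add f.1).le, le_refl _, ?_⟩
    dsimp only
    rw [𝒞.one_comp, 𝒞.pmap_refl]
  comp_id := by
    rintro A B ⟨f⟩
    refine Quotient.sound ⟨f.1, (add_zero f.1).le, le_refl _, ?_⟩
    dsimp only
    rw [𝒞.comp_one, 𝒞.pmap_refl]
  assoc := by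
    rintro A B C D ⟨f⟩ ⟨g⟩ ⟨h⟩
    refine Quotient.sound ⟨f.1 + (g.1 + h.1), (add_assoc _ _ _).le, le_refl _, ?_⟩
    dsimp only
    rw [𝒞.assoc, 𝒞.pmap_refl]

/-- The class in `𝒞_∞` of a morphism of any shift. -/
def cls {A B : 𝒞.Obj} {r : ℝ} (f : 𝒞.Hom A B r) : 𝒞.inf A ⟶ 𝒞.inf B :=
  Quotient.mk (𝒞.infSetoid A B) ⟨r, f⟩

/-! ### Persistence endofunctors and shift functors -/

/-- A persistence endofunctor: it preserves shifts and commutes with the persistence maps. -/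
structure EndoFunctor where
  obj : 𝒞.Obj → 𝒞.Obj
  map : ∀ {A B : 𝒞.Obj} {r : ℝ}, 𝒞.Hom A B r →ₗ[k] 𝒞.Hom (obj A) (obj B) r
  map_pmap : ∀ {A B : 𝒞.Obj} {r s : ℝ} (h : r ≤ s) (f : 𝒞.Hom A B r),
    map (𝒞.pmap h f) = 𝒞.pmap h (map f)
  map_one : ∀ A : 𝒞.Obj, map (𝒞.one A) = 𝒞.one (obj A)
  map_comp : ∀ {A B C : 𝒞.Obj} {r s : ℝ} (f : 𝒞.Hom A B r) (g : 𝒞.Hom B C s),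
    map (𝒞.comp f g) = 𝒞.comp (map f) (map g)

namespace EndoFunctor

/-- The identity persistence functor. -/
def refl : 𝒞.EndoFunctor where
  obj A := A
  map := LinearMap.id
  map_pmap _ _ := rfl
  map_one _ := rfl
  map_comp _ _ := rfl

variable {𝒞}

/-- The persistence functor `A ↦ F (G A)`. -/
def after (F G : 𝒞.EndoFunctor) : 𝒞.EndoFunctor where
  obj A := F.obj (G.obj A)
  map := F.map ∘ₗ G.map
  map_pmap h f := by simp [G.map_pmap, F.map_pmap]
  map_one A := by simp [G.map_one, F.map_one]
  map_comp f g := by simp [G.map_comp, F.map_comp]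

/-- The restriction of a persistence endofunctor to the `0`-level. -/
abbrev zero (F : 𝒞.EndoFunctor) : 𝒞.Obj ⥤ 𝒞.Obj where
  obj A := F.obj A
  map f := F.map f
  map_id A := F.map_one A
  map_comp f g := by
    change F.map (𝒞.pmap _ (𝒞.comp _ _)) = 𝒞.pmap _ (𝒞.comp _ _)
    rw [F.map_pmap, F.map_comp]

end EndoFunctor

/-- A shift functor: a strict monoidal functor from `(ℝ, +)`, seen as the category with exactly one
morphism `r → s` for all `r, s`, to the persistence endofunctors. The morphism `r → s` is sent to a
natural transformation `η r s` of shift `s - r`. -/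
structure ShiftFunctor where
  /-- The persistence functors `Σ^r`. -/
  S : ℝ → 𝒞.EndoFunctor
  /-- The components `Σ^r A → Σ^s A`. -/
  η : ∀ (r s : ℝ) (A : 𝒞.Obj), 𝒞.Hom ((S r).obj A) ((S s).obj A) (s - r)
  η_natural : ∀ (r s : ℝ) {A B : 𝒞.Obj} {a : ℝ} (f : 𝒞.Hom A B a),
    𝒞.comp ((S r).map f) (η r s B) =
      𝒞.pmap (add_comm (s - r) a).le (𝒞.comp (η r s A) ((S s).map f))
  η_self : ∀ (r : ℝ) (A : 𝒞.Obj),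
    η r r A = 𝒞.pmap (sub_self r).symm.le (𝒞.one ((S r).obj A))
  η_comp : ∀ (r s t : ℝ) (A : 𝒞.Obj),
    𝒞.pmap (show (s - r) + (t - s) ≤ t - r by linarith) (𝒞.comp (η r s A) (η s t A)) = η r t A
  S_zero : S 0 = EndoFunctor.refl 𝒞
  S_add : ∀ r s : ℝ, S (r + s) = (S r).after (S s)
  /-- The horizontal composite of `η r r'` and `η s s'` is `η (r + s) (r' + s')`. -/
  η_add : ∀ (r r' s s' : ℝ) (A : 𝒞.Obj),
    HEq (𝒞.comp ((S r).map (η s s' A)) (η r r' ((S s').obj A))) (η (r + s) (r' + s') A)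

namespace ShiftFunctor

variable {𝒞} (Sh : 𝒞.ShiftFunctor)

/-- `Σ^r` on the `0`-level. -/
abbrev zero (r : ℝ) : 𝒞.Obj ⥤ 𝒞.Obj := (Sh.S r).zero

theorem zero_obj_zero (A : 𝒞.Obj) : (Sh.zero 0).obj A = A := by
  change (Sh.S 0).obj A = A
  rw [Sh.S_zero]; rfl

theorem zero_obj_add (r s : ℝ) (A : 𝒞.Obj) :
    (Sh.zero (r + s)).obj A = (Sh.zero r).obj ((Sh.zero s).obj A) := by
  change (Sh.S (r + s)).obj A = (Sh.S r).obj ((Sh.S s).obj A)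
  rw [Sh.S_add]; rfl

theorem zero_obj_two_mul (r : ℝ) (A : 𝒞.Obj) :
    (Sh.zero (2 * r)).obj A = (Sh.zero r).obj ((Sh.zero r).obj A) := by
  rw [two_mul, Sh.zero_obj_add]

theorem zero_obj_neg (r : ℝ) (A : 𝒞.Obj) :
    (Sh.zero r).obj ((Sh.zero (-r)).obj A) = A := by
  rw [← Sh.zero_obj_add, add_neg_cancel, Sh.zero_obj_zero]

/-- `(η_{r,0})_A : Σ^r A → A`, of shift `-r`. -/
def out (r : ℝ) (A : 𝒞.Obj) : 𝒞.Hom ((Sh.zero r).obj A) A (-r) :=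
  𝒞.compTo (show (0 - r) + 0 ≤ -r by linarith) (Sh.η r 0 A) (𝒞.ofEq (Sh.zero_obj_zero A))

/-- `(η_{0,r})_A : A → Σ^r A`, of shift `r`. -/
def into (r : ℝ) (A : 𝒞.Obj) : 𝒞.Hom A ((Sh.zero r).obj A) r :=
  𝒞.compTo (show 0 + (r - 0) ≤ r by linarith) (𝒞.ofEq (Sh.zero_obj_zero A).symm) (Sh.η 0 r A)

/-- The morphism `η_r^A : Σ^r A ⟶ A` of `𝒞₀`, for `r ≥ 0`. -/
def eta (r : ℝ) (hr : 0 ≤ r) (A : 𝒞.Obj) : (Sh.zero r).obj A ⟶ A :=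
  𝒞.pmap (neg_nonpos.mpr hr) (Sh.out r A)

end ShiftFunctor

end PersCat

/-! ### Triangulated persistence categories -/

/-- A triangulated persistence category. The translation functor is `T = shiftFunctor _ 1` and its
inverse is `shiftFunctor _ (-1)`. Since composition is bilinear and the `η r s` are natural, the
persistence structure and the `η r s` are automatically compatible with direct sums in `𝒞₀`. -/
structure TPC (k : Type w) [Field k] where
  cat : PersCat.{w, v, u} k
  Sh : cat.ShiftFunctor
  [hasZeroObject : HasZeroObject cat.Obj]
  [hasShift : HasShift cat.Obj ℤ]
  [additive : ∀ n : ℤ, (shiftFunctor cat.Obj n).Additive]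
  [pretriangulated : Pretriangulated cat.Obj]
  [isTriangulated : IsTriangulated cat.Obj]
  /-- `Σ^r` commutes with `T` on the `0`-level. -/
  comm : ∀ r : ℝ, Sh.zero r ⋙ shiftFunctor cat.Obj (1 : ℤ) =
    shiftFunctor cat.Obj (1 : ℤ) ⋙ Sh.zero r
  /-- `Σ^r` preserves exact triangles. -/
  map_distinguished : ∀ (r : ℝ), ∀ t ∈ distTriang cat.Obj,
    Triangle.mk ((Sh.zero r).map t.mor₁) ((Sh.zero r).map t.mor₂)
      ((Sh.zero r).map t.mor₃ ≫ eqToHom (Functor.congr_obj (comm r) t.obj₁).symm) ∈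
        distTriang cat.Obj
  /-- `T η_r^A = η_r^{TA}`. -/
  shift_eta : ∀ (r : ℝ) (hr : 0 ≤ r) (A : cat.Obj),
    (shiftFunctor cat.Obj (1 : ℤ)).map (Sh.eta r hr A) =
      eqToHom (Functor.congr_obj (comm r) A) ≫ Sh.eta r hr ((shiftFunctor cat.Obj (1 : ℤ)).obj A)
  /-- For `r ≥ 0`, `η_r^A` embeds into an exact triangle with `r`-acyclic third object. -/
  acyclic_cone : ∀ (r : ℝ) (hr : 0 ≤ r) (A : cat.Obj),
    ∃ (K : cat.Obj) (g : A ⟶ K)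
      (h : K ⟶ (shiftFunctor cat.Obj (1 : ℤ)).obj ((Sh.zero r).obj A)),
      Triangle.mk (Sh.eta r hr A) g h ∈ distTriang cat.Obj ∧ cat.IsAcyclic r hr K

namespace TPC

attribute [instance] TPC.hasZeroObject TPC.hasShift TPC.additive TPC.pretriangulated
  TPC.isTriangulated

variable {k : Type w} [Field k] (𝒯 : TPC.{w, v, u} k)

/-- The objects of the triangulated persistence category. -/
abbrev Obj : Type u := 𝒯.cat.Obj

/-- The translation functor `T` of `𝒞₀`. -/
abbrev T : 𝒯.Obj ⥤ 𝒯.Obj := shiftFunctor 𝒯.cat.Obj (1 : ℤ)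

/-- The inverse translation `T⁻¹`. -/
abbrev Tinv : 𝒯.Obj ⥤ 𝒯.Obj := shiftFunctor 𝒯.cat.Obj (-1 : ℤ)

theorem T_obj (r : ℝ) (A : 𝒯.Obj) :
    𝒯.T.obj ((𝒯.Sh.zero r).obj A) = (𝒯.Sh.zero r).obj (𝒯.T.obj A) :=
  Functor.congr_obj (𝒯.comm r) A

/-- The extension of `T` to morphisms `f : A → B` of any shift `r`:
`T f = T (f ∘ (η_{r,0})_A) ∘ (η_{0,r})_{TA}`. -/
def Tmap {A B : 𝒯.Obj} {r : ℝ} (f : 𝒯.cat.Hom A B r) : 𝒯.cat.Hom (𝒯.T.obj A) (𝒯.T.obj B) r :=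
  let f₀ : (𝒯.Sh.zero r).obj A ⟶ B := 𝒯.cat.compTo (neg_add_cancel r).le (𝒯.Sh.out r A) f
  let g₀ : (𝒯.Sh.zero r).obj (𝒯.T.obj A) ⟶ 𝒯.T.obj B := eqToHom (𝒯.T_obj r A).symm ≫ 𝒯.T.map f₀
  𝒯.cat.compTo (add_zero r).le (𝒯.Sh.into r (𝒯.T.obj A)) g₀

/-- `f` is an `r`-isomorphism: it embeds into an exact triangle of `𝒞₀` with `r`-acyclic third
object. -/
def IsRIso (r : ℝ) (hr : 0 ≤ r) {A B : 𝒯.Obj} (f : A ⟶ B) : Prop :=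
  ∃ (K : 𝒯.Obj) (g : B ⟶ K) (h : K ⟶ 𝒯.T.obj A),
    Triangle.mk f g h ∈ distTriang 𝒯.cat.Obj ∧ 𝒯.cat.IsAcyclic r hr K

/-- `A → B → C → Σ^{-r} T A` (morphisms of `𝒞₀`) is a strict exact triangle of weight `r`. -/
def IsStrictExact (r : ℝ) (hr : 0 ≤ r) {A B C : 𝒯.Obj} (u : A ⟶ B) (v : B ⟶ C)
    (w : C ⟶ (𝒯.Sh.zero (-r)).obj (𝒯.T.obj A)) : Prop :=
  ∃ (C' : 𝒯.Obj) (v' : B ⟶ C') (w' : C' ⟶ 𝒯.T.obj A) (φ : C' ⟶ C)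
    (ψ : (𝒯.Sh.zero r).obj C ⟶ C'),
    Triangle.mk u v' w' ∈ distTriang 𝒯.cat.Obj ∧
    𝒯.IsRIso r hr φ ∧
    ψ ≫ φ = 𝒯.Sh.eta r hr C ∧
    v' ≫ φ = v ∧
    ψ ≫ w' = (𝒯.Sh.zero r).map w ≫ eqToHom (𝒯.Sh.zero_obj_neg r (𝒯.T.obj A))

/-! ### Weights of exact triangles in the limit category -/

/-- `A → B → C → T A` is an exact triangle of `𝒞_∞`: it is isomorphic, in `𝒞_∞`, to the image of an
exact triangle of `𝒞₀`. The first component of the isomorphism is given through a representative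
`a`, and `T` acts on it through `Tmap`. -/
def IsExactInf {A B C : 𝒯.Obj} (u : 𝒯.cat.inf A ⟶ 𝒯.cat.inf B) (v : 𝒯.cat.inf B ⟶ 𝒯.cat.inf C)
    (w : 𝒯.cat.inf C ⟶ 𝒯.cat.inf (𝒯.T.obj A)) : Prop :=
  ∃ (A' B' C' : 𝒯.Obj) (u' : A' ⟶ B') (v' : B' ⟶ C') (w' : C' ⟶ 𝒯.T.obj A')
    (r : ℝ) (a : 𝒯.cat.Hom A' A r) (b : 𝒯.cat.inf B' ⟶ 𝒯.cat.inf B)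
    (c : 𝒯.cat.inf C' ⟶ 𝒯.cat.inf C),
    Triangle.mk u' v' w' ∈ distTriang 𝒯.cat.Obj ∧
    IsIso (𝒯.cat.cls a) ∧ IsIso b ∧ IsIso c ∧
    𝒯.cat.cls u' ≫ b = 𝒯.cat.cls a ≫ u ∧
    𝒯.cat.cls v' ≫ c = b ≫ v ∧
    𝒯.cat.cls w' ≫ 𝒯.cat.cls (𝒯.Tmap a) = c ≫ w

/-- The unstable weight `w_∞` of a triangle of `𝒞_∞`: the infimum of the weights of the strict exact
triangles `A → Σ^{-q} B → Σ^{-s} C → Σ^{-r} T A` with `0 ≤ q ≤ s ≤ r` which represent it. -/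
noncomputable def unstableWeight {A B C : 𝒯.Obj} (u : 𝒯.cat.inf A ⟶ 𝒯.cat.inf B)
    (v : 𝒯.cat.inf B ⟶ 𝒯.cat.inf C) (w : 𝒯.cat.inf C ⟶ 𝒯.cat.inf (𝒯.T.obj A)) : ℝ≥0∞ :=
  ⨅ (q : ℝ) (s : ℝ) (r : ℝ) (_ : 0 ≤ q) (_ : q ≤ s) (_ : s ≤ r) (hr : 0 ≤ r)
    (u' : A ⟶ (𝒯.Sh.zero (-q)).obj B)
    (v' : (𝒯.Sh.zero (-q)).obj B ⟶ (𝒯.Sh.zero (-s)).obj C)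
    (w' : (𝒯.Sh.zero (-s)).obj C ⟶ (𝒯.Sh.zero (-r)).obj (𝒯.T.obj A))
    (_ : 𝒯.IsStrictExact r hr u' v' w')
    (_ : 𝒯.cat.cls u' ≫ 𝒯.cat.cls (𝒯.Sh.out (-q) B) = u)
    (_ : 𝒯.cat.cls (𝒯.Sh.into (-q) B) ≫ 𝒯.cat.cls v' ≫ 𝒯.cat.cls (𝒯.Sh.out (-s) C) = v)
    (_ : 𝒯.cat.cls (𝒯.Sh.into (-s) C) ≫ 𝒯.cat.cls w' ≫
      𝒯.cat.cls (𝒯.Sh.out (-r) (𝒯.T.obj A)) = w),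
    ENNReal.ofReal r

/-- The persistence weight `w̄` of a triangle `Δ : A → B → C → T A` of `𝒞_∞`: the infimum over
`s ≥ 0` of the unstable weights of `Σ^{s,0,0,s} Δ : Σ^s A → B → C → T Σ^s A`. -/
noncomputable def weight {A B C : 𝒯.Obj} (u : 𝒯.cat.inf A ⟶ 𝒯.cat.inf B)
    (v : 𝒯.cat.inf B ⟶ 𝒯.cat.inf C) (w : 𝒯.cat.inf C ⟶ 𝒯.cat.inf (𝒯.T.obj A)) : ℝ≥0∞ :=
  ⨅ (s : ℝ) (_ : 0 ≤ s),
    𝒯.unstableWeight (A := (𝒯.Sh.zero s).obj A)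
      (𝒯.cat.cls (𝒯.Sh.out s A) ≫ u) v
      (w ≫ 𝒯.cat.cls (𝒯.Sh.into s (𝒯.T.obj A)) ≫
        𝒯.cat.cls (r := 0) (eqToHom (𝒯.T_obj s A).symm))

/-! ### Fragmentation pseudo-metrics -/

/-- `HasConeDecomp L X c`: in `𝒞_∞` there are exact triangles `X_i → Y_{i-1} → Y_i → T X_i`,
`1 ≤ i ≤ n`, with `Y_0 = 0`, `Y_n = X` and `L = (X_1, …, X_n)`, whose weights add up to `c`. -/
inductive HasConeDecomp : List 𝒯.Obj → 𝒯.Obj → ℝ≥0∞ → Prop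
  | nil {Z : 𝒯.Obj} (hZ : IsZero Z) : HasConeDecomp [] Z 0
  | snoc {L : List 𝒯.Obj} {A Y Y' : 𝒯.Obj} {c : ℝ≥0∞} (h : HasConeDecomp L Y c)
      (u : 𝒯.cat.inf A ⟶ 𝒯.cat.inf Y) (v : 𝒯.cat.inf Y ⟶ 𝒯.cat.inf Y')
      (w : 𝒯.cat.inf Y' ⟶ 𝒯.cat.inf (𝒯.T.obj A)) (huvw : 𝒯.IsExactInf u v w) :
      HasConeDecomp (L ++ [A]) Y' (c + 𝒯.weight u v w)

/-- `δ̄^F (X, X')`: the infimum of the weights of the iterated cone decompositions of `X` with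
linearization `(F_1, …, T⁻¹ X', …, F_k)`, where all `F_i` belong to `F`. -/
noncomputable def fragDelta (F : Set 𝒯.Obj) (X X' : 𝒯.Obj) : ℝ≥0∞ :=
  ⨅ (L₁ : List 𝒯.Obj) (L₂ : List 𝒯.Obj) (c : ℝ≥0∞) (_ : ∀ A ∈ L₁, A ∈ F) (_ : ∀ A ∈ L₂, A ∈ F)
    (_ : 𝒯.HasConeDecomp (L₁ ++ 𝒯.Tinv.obj X' :: L₂) X c), c

/-- The shift-invariant version of `δ̄^F`. -/
noncomputable def fragDeltaHat (F : Set 𝒯.Obj) (X Y : 𝒯.Obj) : ℝ≥0∞ :=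
  ⨅ (r : ℝ) (s : ℝ), 𝒯.fragDelta F ((𝒯.Sh.zero r).obj X) ((𝒯.Sh.zero s).obj Y)

/-- The shift-invariant version of the fragmentation pseudo-metric `d̄^F`. -/
noncomputable def fragDistHat (F : Set 𝒯.Obj) (X Y : 𝒯.Obj) : ℝ≥0∞ :=
  max (𝒯.fragDeltaHat F X Y) (𝒯.fragDeltaHat F Y X)

/-! ### The interleaving pseudo-metric -/

/-- The interleaving pseudo-metric. -/
noncomputable def interleavingDist (X Y : 𝒯.Obj) : ℝ≥0∞ :=
  ⨅ (r : ℝ) (hr : 0 ≤ r) (φ : (𝒯.Sh.zero r).obj X ⟶ Y) (ψ : (𝒯.Sh.zero r).obj Y ⟶ X)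
    (_ : eqToHom (𝒯.Sh.zero_obj_two_mul r X) ≫ (𝒯.Sh.zero r).map φ ≫ ψ =
      𝒯.Sh.eta (2 * r) (mul_nonneg zero_le_two hr) X)
    (_ : eqToHom (𝒯.Sh.zero_obj_two_mul r Y) ≫ (𝒯.Sh.zero r).map ψ ≫ φ =
      𝒯.Sh.eta (2 * r) (mul_nonneg zero_le_two hr) Y),
    ENNReal.ofReal r

/-- The shift-invariant interleaving pseudo-metric. -/
noncomputable def interleavingDistHat (X Y : 𝒯.Obj) : ℝ≥0∞ :=
  ⨅ r : ℝ, 𝒯.interleavingDist ((𝒯.Sh.zero r).obj X) Y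

end TPC

/-!
The total category of a persistence category (same objects, morphisms of all shifts) turns
computations with shifts into computations in an ordinary category. The comparison of the
fragmentation and interleaving distances is carried out there.
-/

namespace PersCat

variable {k : Type w} [Field k] (𝒞 : PersCat.{w, v, u} k)

/-! In the total category, `Σ^r A` and `A` are isomorphic and the persistence maps become
composition with a natural endomorphism `drift r` of the identity. The shift-invariant interleaving
distance then has a symmetric form: `Interleaved X Y (2 * t)` asks for maps both ways, of any
shifts, with both composites equal to `drift (2 * t)`; a shift of `X` balances the two degrees, so
`interleavingDistHat X Y ≤ t` (`interleavingDistHat_le_of_interleaved`). The bridge to triangles is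
a comparison for an exact triangle of `𝒞₀` on `u`: if the cone is `r`-acyclic, the ends of `u` are
`2r`-interleaved (`interleaved_of_isAcyclic_cone`); if `u` has an inverse up to `drift r`, its cone
is `2r`-acyclic (`isAcyclic_cone`). Lower bound: a triangle of weight `< ε` is, up to a
`2ε`-interleaving of its third object and up to shifts, an exact triangle of `𝒞₀`. In a cone
decomposition over `{0}`, the steps before `T⁻¹ X'` keep the partial cone acyclic, at a level twice
the weight spent. Attaching `T⁻¹ X'` to it doubles that level once more, and the later steps cost
twice their weight. Hence total weight `< ε` gives a `4ε`-interleaving, that is `interleavingDistHat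
≤ 2ε`. Upper bound: a `t`-interleaving gives `φ : Σ^t X ⟶ Y` with an inverse up to `drift (2t)`, so
its cone is `4t`-acyclic. The single triangle `T⁻¹ Σ^t X → 0 → Y → T T⁻¹ Σ^t X` is then a
decomposition of weight at most `4t`, using no member of the family. -/

/-- The objects of the total category of a persistence category: the morphisms are the morphisms
of all shifts. -/
structure Tot where
  obj : 𝒞.Obj

/-- The object `A`, viewed as an object of the total category. -/
abbrev tot (A : 𝒞.Obj) : 𝒞.Tot := ⟨A⟩

variable {𝒞} in
theorem sigma_hom_ext {A B : 𝒞.Obj} {r s : ℝ} {f : 𝒞.Hom A B r} {g : 𝒞.Hom A B s} (h : r = s)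
    (hfg : 𝒞.pmap h.le f = g) : (⟨r, f⟩ : Σ r : ℝ, 𝒞.Hom A B r) = ⟨s, g⟩ := by
  subst h
  rw [𝒞.pmap_refl] at hfg
  rw [hfg]

/-- The total category of a persistence category. -/
instance totCategory : Category.{v} 𝒞.Tot where
  Hom A B := Σ r : ℝ, 𝒞.Hom A.obj B.obj r
  id A := ⟨0, 𝒞.one A.obj⟩
  comp f g := ⟨f.1 + g.1, 𝒞.comp f.2 g.2⟩
  id_comp f := sigma_hom_ext (zero_add _) (𝒞.one_comp f.2)
  comp_id f := sigma_hom_ext (add_zero _) (𝒞.comp_one f.2)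
  assoc f g h := sigma_hom_ext (add_assoc _ _ _) (𝒞.assoc f.2 g.2 h.2)

variable {𝒞}

/-- A morphism of shift `r`, viewed in the total category. -/
def hom {A B : 𝒞.Obj} {r : ℝ} (f : 𝒞.Hom A B r) : 𝒞.tot A ⟶ 𝒞.tot B := ⟨r, f⟩

/-- The shift of a morphism of the total category. -/
def deg {A B : 𝒞.Tot} (f : A ⟶ B) : ℝ := f.1

/-- A morphism of the total category is null if it is the zero of its persistence level. -/
def IsNull {A B : 𝒞.Tot} (f : A ⟶ B) : Prop := f.2 = 0

@[simp] theorem deg_hom {A B : 𝒞.Obj} {r : ℝ} (f : 𝒞.Hom A B r) : deg (hom f) = r := rfl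

@[simp] theorem deg_comp {A B C : 𝒞.Tot} (f : A ⟶ B) (g : B ⟶ C) :
    deg (f ≫ g) = deg f + deg g := rfl

@[simp] theorem deg_id (A : 𝒞.Tot) : deg (𝟙 A) = 0 := rfl

@[simp] theorem deg_eqToHom {A B : 𝒞.Tot} (h : A = B) : deg (eqToHom h) = 0 := by
  subst h; rfl

theorem hom_eq_iff {A B : 𝒞.Obj} {r : ℝ} {f g : 𝒞.Hom A B r} : hom f = hom g ↔ f = g := by
  refine ⟨fun h => ?_, fun h => h ▸ rfl⟩
  exact eq_of_heq (Sigma.mk.inj h).2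

theorem exists_hom_eq {A B : 𝒞.Obj} (f : 𝒞.tot A ⟶ 𝒞.tot B) {r : ℝ} (h : deg f = r) :
    ∃ f₀ : 𝒞.Hom A B r, hom f₀ = f := by
  subst h
  exact ⟨f.2, rfl⟩

theorem exists_arrow_eq {A B : 𝒞.Obj} (f : 𝒞.tot A ⟶ 𝒞.tot B) (h : deg f = 0) :
    ∃ f₀ : A ⟶ B, hom (r := 0) f₀ = f :=
  exists_hom_eq f h

theorem hom_comp {A B C : 𝒞.Obj} {r s : ℝ} (f : 𝒞.Hom A B r) (g : 𝒞.Hom B C s) :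
    hom (𝒞.comp f g) = hom f ≫ hom g := rfl

theorem hom_pmap_of_eq {A B : 𝒞.Obj} {r s : ℝ} (h : r ≤ s) (h' : r = s) (f : 𝒞.Hom A B r) :
    hom (𝒞.pmap h f) = hom f :=
  (sigma_hom_ext h' rfl).symm

theorem hom_compTo_of_eq {A B C : 𝒞.Obj} {r s t : ℝ} (h : r + s ≤ t) (h' : r + s = t)
    (f : 𝒞.Hom A B r) (g : 𝒞.Hom B C s) : hom (𝒞.compTo h f g) = hom f ≫ hom g :=
  hom_pmap_of_eq h h' _

theorem hom_one (A : 𝒞.Obj) : hom (𝒞.one A) = 𝟙 (𝒞.tot A) := rfl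

theorem hom_arrow_comp {A B C : 𝒞.Obj} (f : A ⟶ B) (g : B ⟶ C) :
    hom (r := 0) (f ≫ g) = hom (r := 0) f ≫ hom (r := 0) g :=
  hom_compTo_of_eq _ (add_zero 0) f g

theorem hom_arrow_id (A : 𝒞.Obj) : hom (r := 0) (𝟙 A) = 𝟙 (𝒞.tot A) := rfl

theorem hom_ofEq {A B : 𝒞.Obj} (h : A = B) : hom (𝒞.ofEq h) = eqToHom (congrArg 𝒞.tot h) := by
  subst h; rfl

theorem hom_eqToHom {A B : 𝒞.Obj} (h : A = B) :
    hom (r := 0) (eqToHom h) = eqToHom (congrArg 𝒞.tot h) := by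
  subst h; rfl

/-- An isomorphism of the `0`-level, viewed in the total category. -/
def isoTot {A B : 𝒞.Obj} (e : A ≅ B) : 𝒞.tot A ≅ 𝒞.tot B where
  hom := hom (r := 0) e.hom
  inv := hom (r := 0) e.inv
  hom_inv_id := by rw [← hom_arrow_comp, e.hom_inv_id, hom_arrow_id]
  inv_hom_id := by rw [← hom_arrow_comp, e.inv_hom_id, hom_arrow_id]

/-- The image of the identity of `A` under the persistence map `0 ≤ r`. -/
def drift (r : ℝ) (hr : 0 ≤ r) (A : 𝒞.Tot) : A ⟶ A := ⟨r, 𝒞.pmap hr (𝒞.one A.obj)⟩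

@[simp] theorem deg_drift (r : ℝ) (hr : 0 ≤ r) (A : 𝒞.Tot) : deg (drift r hr A) = r := rfl

theorem drift_comp {A B : 𝒞.Tot} (r : ℝ) (hr : 0 ≤ r) (f : A ⟶ B) :
    drift r hr A ≫ f = ⟨r + f.1, 𝒞.pmap (by linarith) f.2⟩ := by
  refine sigma_hom_ext rfl ?_
  have := 𝒞.compTo_pmap hr le_rfl le_rfl (𝒞.one A.obj) f.2
  rw [𝒞.one_compTo, 𝒞.pmap_refl] at this
  exact this

theorem comp_drift {A B : 𝒞.Tot} (r : ℝ) (hr : 0 ≤ r) (f : A ⟶ B) :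
    f ≫ drift r hr B = ⟨f.1 + r, 𝒞.pmap (by linarith) f.2⟩ := by
  refine sigma_hom_ext rfl ?_
  have := 𝒞.compTo_pmap le_rfl hr le_rfl f.2 (𝒞.one B.obj)
  rw [𝒞.compTo_one, 𝒞.pmap_refl] at this
  exact this

/-- Naturality of `drift`: both sides are the image of `f` under the persistence map by `r`. It lets
a drift be moved to any place in a composite. -/
theorem comp_drift_hom {A B : 𝒞.Tot} (r : ℝ) (hr : 0 ≤ r) (f : A ⟶ B) :
    f ≫ drift r hr B = drift r hr A ≫ f := by
  rw [drift_comp, comp_drift]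
  exact sigma_hom_ext (add_comm _ _) (𝒞.pmap_pmap _ _ _)

theorem drift_comp_drift {r s : ℝ} (hr : 0 ≤ r) (hs : 0 ≤ s) (A : 𝒞.Tot) :
    drift r hr A ≫ drift s hs A = drift (r + s) (add_nonneg hr hs) A := by
  rw [drift_comp]
  refine sigma_hom_ext rfl ?_
  refine (𝒞.pmap_refl _).trans ?_
  exact 𝒞.pmap_pmap _ _ _

theorem hom_pmap {A B : 𝒞.Obj} {r s : ℝ} (h : r ≤ s) (f : 𝒞.Hom A B r) :
    hom (𝒞.pmap h f) = hom f ≫ drift (s - r) (sub_nonneg.mpr h) _ := by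
  rw [comp_drift]
  exact sigma_hom_ext (by simp [hom]) (𝒞.pmap_pmap _ _ _)

theorem isAcyclic_iff {r : ℝ} {hr : 0 ≤ r} {A : 𝒞.Obj} :
    𝒞.IsAcyclic r hr A ↔ IsNull (drift r hr (𝒞.tot A)) := Iff.rfl

theorem IsNull.comp {A B C : 𝒞.Tot} {f : A ⟶ B} (hf : IsNull f) (g : B ⟶ C) :
    IsNull (f ≫ g) := by
  change 𝒞.comp f.2 g.2 = 0
  rw [show f.2 = 0 from hf, map_zero, LinearMap.zero_apply]

theorem IsNull.comp_left {B C : 𝒞.Tot} {g : B ⟶ C} (hg : IsNull g) {A : 𝒞.Tot} (f : A ⟶ B) :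
    IsNull (f ≫ g) := by
  change 𝒞.comp f.2 g.2 = 0
  rw [show g.2 = 0 from hg, map_zero]

theorem isNull_id_of_isZero {A : 𝒞.Obj} (hA : IsZero A) : IsNull (𝟙 (𝒞.tot A)) :=
  hA.eq_of_src (𝟙 A) 0

/-- The projection from the total category to the limit category. -/
def toInf {A B : 𝒞.Obj} (f : 𝒞.tot A ⟶ 𝒞.tot B) : 𝒞.inf A ⟶ 𝒞.inf B := 𝒞.cls f.2

theorem toInf_hom {A B : 𝒞.Obj} {r : ℝ} (f : 𝒞.Hom A B r) : toInf (hom f) = 𝒞.cls f := rfl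

theorem toInf_comp {A B C : 𝒞.Obj} (f : 𝒞.tot A ⟶ 𝒞.tot B) (g : 𝒞.tot B ⟶ 𝒞.tot C) :
    toInf (f ≫ g) = toInf f ≫ toInf g := rfl

theorem toInf_drift (r : ℝ) (hr : 0 ≤ r) (A : 𝒞.Obj) :
    toInf (drift r hr (𝒞.tot A)) = 𝟙 _ :=
  Quotient.sound ⟨r, le_rfl, hr, 𝒞.pmap_refl _⟩

theorem toInf_eq_of_isNull {A B : 𝒞.Obj} {f g : 𝒞.tot A ⟶ 𝒞.tot B} (hf : IsNull f)
    (hg : IsNull g) : toInf f = toInf g :=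
  Quotient.sound ⟨max f.1 g.1, le_max_left _ _, le_max_right _ _, by
    rw [show f.2 = 0 from hf, show g.2 = 0 from hg, map_zero, map_zero]⟩

theorem inf_hom_eq_of_isZero_tgt {A B : 𝒞.Obj} (hB : IsZero B) (f g : 𝒞.inf A ⟶ 𝒞.inf B) :
    f = g := by
  obtain ⟨f⟩ := f
  obtain ⟨g⟩ := g
  refine toInf_eq_of_isNull (A := A) (B := B) (f := f) (g := g) ?_ ?_
  · have := (isNull_id_of_isZero hB).comp_left (A := 𝒞.tot A) f
    rwa [Category.comp_id] at this
  · have := (isNull_id_of_isZero hB).comp_left (A := 𝒞.tot A) g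
    rwa [Category.comp_id] at this

theorem inf_hom_eq_of_isZero_src {A B : 𝒞.Obj} (hA : IsZero A) (f g : 𝒞.inf A ⟶ 𝒞.inf B) :
    f = g := by
  obtain ⟨f⟩ := f
  obtain ⟨g⟩ := g
  refine toInf_eq_of_isNull (A := A) (B := B) (f := f) (g := g) ?_ ?_
  · have := (isNull_id_of_isZero hA).comp (C := 𝒞.tot B) f
    rwa [Category.id_comp] at this
  · have := (isNull_id_of_isZero hA).comp (C := 𝒞.tot B) g
    rwa [Category.id_comp] at this

/-! ### Endofunctors and shift functors in the total category. -/

namespace EndoFunctor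

/-- The action of a persistence endofunctor on morphisms of the total category. -/
def totMap (F : 𝒞.EndoFunctor) {A B : 𝒞.Obj} (f : 𝒞.tot A ⟶ 𝒞.tot B) :
    𝒞.tot (F.obj A) ⟶ 𝒞.tot (F.obj B) :=
  hom (F.map f.2)

theorem totMap_hom (F : 𝒞.EndoFunctor) {A B : 𝒞.Obj} {r : ℝ} (f : 𝒞.Hom A B r) :
    F.totMap (hom f) = hom (F.map f) := rfl

theorem totMap_of_eq_refl {F : 𝒞.EndoFunctor} (hF : F = refl 𝒞) {A B : 𝒞.Obj}
    (f : 𝒞.tot A ⟶ 𝒞.tot B) : F.totMap f =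
      eqToHom (by rw [hF]; rfl) ≫ f ≫ eqToHom (by rw [hF]; rfl) := by
  subst hF
  exact ((Category.id_comp _).trans (Category.comp_id f)).symm

end EndoFunctor

namespace ShiftFunctor

variable (Sh : 𝒞.ShiftFunctor)

/-- Turns the axiom `η_add`, a heterogeneous equality, into an equation between composites in the
total category. -/
theorem hom_eq_of_heq {A A' B B' : 𝒞.Obj} {r s : ℝ} {f : 𝒞.Hom A B r} {g : 𝒞.Hom A' B' s}
    (h : HEq f g) (hA : A' = A) (hB : B = B') (hr : r = s) :
    hom g = eqToHom (congrArg 𝒞.tot hA) ≫ hom f ≫ eqToHom (congrArg 𝒞.tot hB) := by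
  subst hA hB hr
  simp [eq_of_heq h]

/-- `Σ^r` on the morphisms of the total category. -/
abbrev tS (r : ℝ) {A B : 𝒞.Obj} (f : 𝒞.tot A ⟶ 𝒞.tot B) :
    𝒞.tot ((Sh.zero r).obj A) ⟶ 𝒞.tot ((Sh.zero r).obj B) :=
  (Sh.S r).totMap f

/-- `Σ^r A → A` in the total category. -/
abbrev tout (r : ℝ) (A : 𝒞.Obj) : 𝒞.tot ((Sh.zero r).obj A) ⟶ 𝒞.tot A := hom (Sh.out r A)

/-- `A → Σ^r A` in the total category. -/
abbrev tinto (r : ℝ) (A : 𝒞.Obj) : 𝒞.tot A ⟶ 𝒞.tot ((Sh.zero r).obj A) := hom (Sh.into r A)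

theorem tout_eq (r : ℝ) (A : 𝒞.Obj) : Sh.tout r A =
    hom (Sh.η r 0 A) ≫ eqToHom (congrArg 𝒞.tot (Sh.zero_obj_zero A)) := by
  rw [tout, out, hom_compTo_of_eq _ (by ring), hom_ofEq]

theorem tinto_eq (r : ℝ) (A : 𝒞.Obj) : Sh.tinto r A =
    eqToHom (congrArg 𝒞.tot (Sh.zero_obj_zero A).symm) ≫ hom (Sh.η 0 r A) := by
  rw [tinto, into, hom_compTo_of_eq _ (by ring), hom_ofEq]

theorem hom_η_comp (r s t : ℝ) (A : 𝒞.Obj) :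
    hom (Sh.η r s A) ≫ hom (Sh.η s t A) = hom (Sh.η r t A) := by
  rw [← hom_comp, ← Sh.η_comp r s t A, hom_pmap_of_eq _ (by ring)]

theorem hom_η_self (r : ℝ) (A : 𝒞.Obj) : hom (Sh.η r r A) = 𝟙 _ := by
  rw [Sh.η_self, hom_pmap_of_eq _ (by ring), hom_one]

theorem hom_η_natural (r s : ℝ) {A B : 𝒞.Obj} (f : 𝒞.tot A ⟶ 𝒞.tot B) :
    Sh.tS r f ≫ hom (Sh.η r s B) = hom (Sh.η r s A) ≫ Sh.tS s f := by
  change hom (𝒞.comp ((Sh.S r).map f.2) (Sh.η r s B)) = _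
  rw [Sh.η_natural, hom_pmap_of_eq _ (by ring)]
  rfl

@[simp]
theorem tinto_tout (r : ℝ) (A : 𝒞.Obj) : Sh.tinto r A ≫ Sh.tout r A = 𝟙 _ := by
  rw [tout_eq, tinto_eq]
  simp [reassoc_of% (Sh.hom_η_comp 0 r 0 A), hom_η_self]

@[simp]
theorem tout_tinto (r : ℝ) (A : 𝒞.Obj) : Sh.tout r A ≫ Sh.tinto r A = 𝟙 _ := by
  rw [tout_eq, tinto_eq]
  simp [hom_η_comp, hom_η_self]

@[simp]
theorem tinto_tout_assoc (r : ℝ) {A : 𝒞.Obj} {B : 𝒞.Tot} (f : 𝒞.tot A ⟶ B) :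
    Sh.tinto r A ≫ Sh.tout r A ≫ f = f := by
  rw [← Category.assoc, tinto_tout, Category.id_comp]

@[simp]
theorem tout_tinto_assoc (r : ℝ) {A : 𝒞.Obj} {B : 𝒞.Tot}
    (f : 𝒞.tot ((Sh.zero r).obj A) ⟶ B) : Sh.tout r A ≫ Sh.tinto r A ≫ f = f := by
  rw [← Category.assoc, tout_tinto, Category.id_comp]

theorem tS_zero {A B : 𝒞.Obj} (f : 𝒞.tot A ⟶ 𝒞.tot B) :
    Sh.tS 0 f = eqToHom (congrArg 𝒞.tot (Sh.zero_obj_zero A)) ≫ f ≫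
      eqToHom (congrArg 𝒞.tot (Sh.zero_obj_zero B).symm) :=
  EndoFunctor.totMap_of_eq_refl Sh.S_zero f

theorem tout_natural (r : ℝ) {A B : 𝒞.Obj} (f : 𝒞.tot A ⟶ 𝒞.tot B) :
    Sh.tS r f ≫ Sh.tout r B = Sh.tout r A ≫ f := by
  rw [tout_eq, tout_eq, ← Category.assoc, hom_η_natural, Category.assoc, Category.assoc,
    tS_zero]
  simp

theorem tinto_natural (r : ℝ) {A B : 𝒞.Obj} (f : 𝒞.tot A ⟶ 𝒞.tot B) :
    f ≫ Sh.tinto r B = Sh.tinto r A ≫ Sh.tS r f := by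
  calc f ≫ Sh.tinto r B = Sh.tinto r A ≫ (Sh.tout r A ≫ f) ≫ Sh.tinto r B := by simp
    _ = Sh.tinto r A ≫ Sh.tS r f := by rw [← tout_natural]; simp

theorem tout_zero (A : 𝒞.Obj) :
    Sh.tout 0 A = eqToHom (congrArg 𝒞.tot (Sh.zero_obj_zero A)) := by
  rw [tout_eq, hom_η_self, Category.id_comp]

/-- This is `η_add` with both targets at level `0`; naturality of `tout` then exchanges the two
factors. -/
theorem tout_add (r s : ℝ) (A : 𝒞.Obj) : Sh.tout (r + s) A =
    eqToHom (congrArg 𝒞.tot (Sh.zero_obj_add r s A)) ≫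
      Sh.tout r ((Sh.zero s).obj A) ≫ Sh.tout s A := by
  have h := hom_eq_of_heq (Sh.η_add r 0 s 0 A) (Sh.zero_obj_add r s A)
    (Sh.zero_obj_add 0 0 A).symm (by ring)
  -- The axiom ends at level `0 + 0`, which is only propositionally `0`, so the target has to be
  -- transported.
  have h0 : hom (Sh.η (r + s) (0 + 0) A) ≫ eqToHom (by rw [add_zero]) =
      hom (Sh.η (r + s) 0 A) := by
    have : ∀ t (ht : t = 0), hom (Sh.η (r + s) t A) ≫ eqToHom (by rw [ht]) =
      hom (Sh.η (r + s) 0 A) := by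
      rintro _ rfl
      simp
    exact this _ (add_zero 0)
  rw [tout_eq, ← h0, h, hom_comp, ← EndoFunctor.totMap_hom]
  have h1 : hom (Sh.η s 0 A) =
    Sh.tout s A ≫ eqToHom (congrArg 𝒞.tot (Sh.zero_obj_zero A).symm) := by
    rw [tout_eq]; simp
  have h2 : hom (Sh.η r 0 ((Sh.S 0).obj A)) = Sh.tout r ((Sh.S 0).obj A) ≫
      eqToHom (congrArg 𝒞.tot (Sh.zero_obj_zero _).symm) := by
    rw [tout_eq]; simp
  rw [h2, ← Category.assoc ((Sh.S r).totMap _) (Sh.tout r _), Sh.tout_natural, h1]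
  simp

theorem tout_tout_neg (r : ℝ) (A : 𝒞.Obj) :
    Sh.tout r ((Sh.zero (-r)).obj A) ≫ Sh.tout (-r) A =
      eqToHom (congrArg 𝒞.tot (Sh.zero_obj_neg r A)) := by
  have h := Sh.tout_add r (-r) A
  have h0 : Sh.tout (r + -r) A = eqToHom
      (congrArg 𝒞.tot (by rw [add_neg_cancel, Sh.zero_obj_zero])) := by
    have : ∀ t (ht : t = 0), Sh.tout t A = eqToHom (by subst ht; rw [Sh.zero_obj_zero]) := by
      rintro _ rfl
      exact Sh.tout_zero A
    exact this _ (by ring)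
  rw [h0] at h
  rw [← cancel_epi (eqToHom (congrArg 𝒞.tot (Sh.zero_obj_add r (-r) A))), ← h]
  simp

theorem tout_two_mul (r : ℝ) (A : 𝒞.Obj) : Sh.tout (2 * r) A =
    eqToHom (congrArg 𝒞.tot (Sh.zero_obj_two_mul r A)) ≫
      Sh.tout r ((Sh.zero r).obj A) ≫ Sh.tout r A := by
  have : ∀ t (ht : t = r + r), Sh.tout t A =
      eqToHom (by subst ht; rw [Sh.zero_obj_add]) ≫
        Sh.tout r ((Sh.zero r).obj A) ≫ Sh.tout r A := by
    rintro _ rfl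
    exact Sh.tout_add r r A
  exact this _ (two_mul r)

theorem hom_eta (r : ℝ) (hr : 0 ≤ r) (A : 𝒞.Obj) :
    hom (r := 0) (Sh.eta r hr A) = Sh.tout r A ≫ drift r hr _ := by
  rw [eta, hom_pmap]
  congr 1
  congr 1
  ring

theorem hom_zero_map (r : ℝ) {A B : 𝒞.Obj} (f : A ⟶ B) :
    hom (r := 0) ((Sh.zero r).map f) = Sh.tS r (hom (r := 0) f) := rfl

/-- `Σ^r A` and `A` are isomorphic in the total category. -/
def toutIso (r : ℝ) (A : 𝒞.Obj) : 𝒞.tot ((Sh.zero r).obj A) ≅ 𝒞.tot A where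
  hom := Sh.tout r A
  inv := Sh.tinto r A

@[simp] theorem deg_tout (r : ℝ) (A : 𝒞.Obj) : deg (Sh.tout r A) = -r := rfl

@[simp] theorem deg_tinto (r : ℝ) (A : 𝒞.Obj) : deg (Sh.tinto r A) = r := rfl

end ShiftFunctor

end PersCat

/-! ### Lifting problems in arbitrary shift, and interleavings up to shift. -/

namespace PersCat

variable {k : Type w} [Field k] {𝒞 : PersCat.{w, v, u} k}

theorem isNull_iso_comp {A B C : 𝒞.Tot} (e : A ≅ B) (f : B ⟶ C) :
    IsNull (e.hom ≫ f) ↔ IsNull f := by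
  refine ⟨fun h => ?_, fun h => h.comp_left _⟩
  have := h.comp_left e.inv
  rwa [e.inv_hom_id_assoc] at this

theorem isNull_hom_arrow {A B : 𝒞.Obj} {f : A ⟶ B} : IsNull (hom (r := 0) f) ↔ f = 0 := Iff.rfl

/-- A weak kernel in the `0`-level is a weak kernel for morphisms of any shift. -/
theorem ShiftFunctor.exists_lift (Sh : 𝒞.ShiftFunctor) {A B C : 𝒞.Obj} {u : A ⟶ B} {v : B ⟶ C}
    (H : ∀ {X : 𝒞.Obj} (f : X ⟶ B), f ≫ v = 0 → ∃ g : X ⟶ A, f = g ≫ u)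
    {X : 𝒞.Obj} (f : 𝒞.tot X ⟶ 𝒞.tot B) (hf : IsNull (f ≫ hom (r := 0) v)) :
    ∃ g : 𝒞.tot X ⟶ 𝒞.tot A, f = g ≫ hom (r := 0) u := by
  -- Precomposing with the isomorphism `Σ^{deg f} X → X`, of shift `-deg f`, brings `f` down to
  -- shift `0`, where the hypothesis applies.
  obtain ⟨f₀, h₀⟩ := exists_arrow_eq (Sh.tout (deg f) X ≫ f) (by simp)
  obtain ⟨g, hg⟩ := H f₀ (by
    rw [← isNull_hom_arrow, hom_arrow_comp, h₀, Category.assoc]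
    exact hf.comp_left _)
  refine ⟨Sh.tinto (deg f) X ≫ hom (r := 0) g, ?_⟩
  rw [Category.assoc, ← hom_arrow_comp, ← hg, h₀]
  simp

/-- A weak cokernel in the `0`-level is a weak cokernel for morphisms of any shift. -/
theorem ShiftFunctor.exists_desc (Sh : 𝒞.ShiftFunctor) {A B C : 𝒞.Obj} {u : A ⟶ B} {v : B ⟶ C}
    (H : ∀ {X : 𝒞.Obj} (f : B ⟶ X), u ≫ f = 0 → ∃ g : C ⟶ X, f = v ≫ g)
    {X : 𝒞.Obj} (f : 𝒞.tot B ⟶ 𝒞.tot X) (hf : IsNull (hom (r := 0) u ≫ f)) :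
    ∃ g : 𝒞.tot C ⟶ 𝒞.tot X, f = hom (r := 0) v ≫ g := by
  obtain ⟨f₀, h₀⟩ := exists_arrow_eq (f ≫ Sh.tinto (-deg f) X) (by simp)
  obtain ⟨g, hg⟩ := H f₀ (by
    rw [← isNull_hom_arrow, hom_arrow_comp, h₀, ← Category.assoc]
    exact hf.comp _)
  refine ⟨hom (r := 0) g ≫ Sh.tout (-deg f) X, ?_⟩
  rw [← Category.assoc, ← hom_arrow_comp, ← hg, h₀]
  simp

/-- `A` and `B` are `e`-interleaved up to shift: there are morphisms `A → B` and `B → A`, of any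
shifts, whose composites are the images of the identities under the persistence map `0 ≤ e`. -/
def Interleaved (A B : 𝒞.Obj) (e : ℝ) : Prop :=
  ∃ (he : 0 ≤ e) (f : 𝒞.tot A ⟶ 𝒞.tot B) (g : 𝒞.tot B ⟶ 𝒞.tot A),
    f ≫ g = drift e he _ ∧ g ≫ f = drift e he _

theorem Interleaved.symm {A B : 𝒞.Obj} {e : ℝ} (h : Interleaved A B e) : Interleaved B A e := by
  obtain ⟨he, f, g, h1, h2⟩ := h
  exact ⟨he, g, f, h2, h1⟩

theorem interleaved_of_iso {A B : 𝒞.Obj} (i : 𝒞.tot A ≅ 𝒞.tot B) {e : ℝ} (he : 0 ≤ e) :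
    Interleaved A B e :=
  ⟨he, i.hom, i.inv ≫ drift e he _, by simp, by simp [comp_drift_hom]⟩

theorem Interleaved.trans {A B C : 𝒞.Obj} {e e' : ℝ} (h : Interleaved A B e)
    (h' : Interleaved B C e') : Interleaved A C (e + e') := by
  obtain ⟨he, f, g, h1, h2⟩ := h
  obtain ⟨he', f', g', h1', h2'⟩ := h'
  refine ⟨add_nonneg he he', f ≫ f', g' ≫ g, ?_, ?_⟩
  · rw [Category.assoc, ← Category.assoc f', h1', ← comp_drift_hom, ← Category.assoc, h1,
      drift_comp_drift]
  · rw [Category.assoc, ← Category.assoc g, h2, ← comp_drift_hom, ← Category.assoc, h2',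
      drift_comp_drift]
    congr 1
    ring

theorem Interleaved.mono {A B : 𝒞.Obj} {e e' : ℝ} (h : Interleaved A B e) (hee' : e ≤ e') :
    Interleaved A B e' := by
  have := h.trans (interleaved_of_iso (Iso.refl (𝒞.tot B)) (sub_nonneg.mpr hee'))
  rwa [add_sub_cancel] at this

theorem Interleaved.trans_iso {A B C : 𝒞.Obj} {e : ℝ} (h : Interleaved A B e)
    (i : 𝒞.tot B ≅ 𝒞.tot C) : Interleaved A C e := by
  simpa using h.trans (interleaved_of_iso i le_rfl)

/-- On `B`, `drift e` factors through `A`; sliding `drift r` onto `A` kills the composite. -/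
theorem Interleaved.isAcyclic {A B : 𝒞.Obj} {e r : ℝ} {hr : 0 ≤ r} (h : Interleaved A B e)
    (hA : 𝒞.IsAcyclic r hr A) : 𝒞.IsAcyclic (r + e) (add_nonneg hr h.choose) B := by
  have he := h.choose
  obtain ⟨_, f, g, h1, h2⟩ := h
  rw [isAcyclic_iff] at hA ⊢
  rw [← drift_comp_drift hr he, ← h2, ← Category.assoc, ← comp_drift_hom, Category.assoc]
  exact (hA.comp f).comp_left g

theorem isAcyclic_zero_of_isZero {A : 𝒞.Obj} (hA : IsZero A) : 𝒞.IsAcyclic 0 le_rfl A := by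
  rw [isAcyclic_iff, ← Category.id_comp (drift _ _ _)]
  exact (isNull_id_of_isZero hA).comp _

theorem IsAcyclic.mono {A : 𝒞.Obj} {r s : ℝ} {hr : 0 ≤ r} (hA : 𝒞.IsAcyclic r hr A)
    (hrs : r ≤ s) : 𝒞.IsAcyclic s (hr.trans hrs) A := by
  have := (interleaved_of_iso (Iso.refl (𝒞.tot A)) (sub_nonneg.mpr hrs)).isAcyclic hA
  simpa [add_sub_cancel] using this

end PersCat

/-! ### Acyclic cones versus inverses up to drift. -/

namespace TPC

open PersCat

variable {k : Type w} [Field k] (𝒯 : TPC.{w, v, u} k)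

theorem isNull_drift_comp_iff {A B : 𝒯.Obj} (f : A ⟶ B) (r : ℝ) (hr : 0 ≤ r) :
    IsNull (drift r hr _ ≫ hom (r := 0) f) ↔ 𝒯.Sh.eta r hr A ≫ f = 0 := by
  rw [← isNull_hom_arrow, hom_arrow_comp, ShiftFunctor.hom_eta, Category.assoc]
  exact (isNull_iso_comp (𝒯.Sh.toutIso r A) _).symm

/-- Vanishing after a drift is the same as vanishing after `η_r`, a statement inside `𝒞₀`. There `T`
is faithful and carries `η_r^A` to `η_r^{TA}`. -/
theorem isNull_drift_comp_T_iff {A B : 𝒯.Obj} (f : A ⟶ B) (r : ℝ) (hr : 0 ≤ r) :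
    IsNull (drift r hr _ ≫ hom (r := 0) (𝒯.T.map f)) ↔
      IsNull (drift r hr _ ≫ hom (r := 0) f) := by
  rw [isNull_drift_comp_iff, isNull_drift_comp_iff,
    ← 𝒯.T.map_eq_zero_iff (f := 𝒯.Sh.eta r hr A ≫ f), 𝒯.T.map_comp, 𝒯.shift_eta, Category.assoc]
  refine ⟨fun h => by rw [h, comp_zero], fun h => ?_⟩
  rw [← cancel_epi (eqToHom (Functor.congr_obj (𝒯.comm r) A)), h, comp_zero]

theorem hom_lift {A B C : 𝒯.Obj} {u : A ⟶ B} {v : B ⟶ C} {w : C ⟶ 𝒯.T.obj A}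
    (H : Triangle.mk u v w ∈ distTriang 𝒯.cat.Obj) {X : 𝒯.Obj} (f : 𝒯.cat.tot X ⟶ 𝒯.cat.tot B)
    (hf : IsNull (f ≫ hom (r := 0) v)) :
    ∃ g : 𝒯.cat.tot X ⟶ 𝒯.cat.tot A, f = g ≫ hom (r := 0) u :=
  𝒯.Sh.exists_lift (fun f hf => Triangle.coyoneda_exact₂ _ H f hf) f hf

theorem hom_desc {A B C : 𝒯.Obj} {u : A ⟶ B} {v : B ⟶ C} {w : C ⟶ 𝒯.T.obj A}
    (H : Triangle.mk u v w ∈ distTriang 𝒯.cat.Obj) {X : 𝒯.Obj} (f : 𝒯.cat.tot B ⟶ 𝒯.cat.tot X)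
    (hf : IsNull (hom (r := 0) u ≫ f)) :
    ∃ g : 𝒯.cat.tot C ⟶ 𝒯.cat.tot X, f = hom (r := 0) v ≫ g :=
  𝒯.Sh.exists_desc (fun f hf => Triangle.yoneda_exact₂ _ H f hf) f hf

/-- The connecting morphism of an exact triangle desuspends. -/
theorem exists_desuspension {C A : 𝒯.Obj} (w : C ⟶ 𝒯.T.obj A) :
    ∃ (C₀ : 𝒯.Obj) (w₀ : C₀ ⟶ A) (e : 𝒯.T.obj C₀ ≅ C), 𝒯.T.map w₀ = e.hom ≫ w := by
  let e : 𝒯.T.obj (𝒯.Tinv.obj C) ≅ C := (shiftEquiv 𝒯.cat.Obj (1 : ℤ)).counitIso.app C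
  obtain ⟨w₀, hw₀⟩ := 𝒯.T.map_surjective (e.hom ≫ w)
  exact ⟨_, w₀, e, hw₀⟩

theorem isNull_desuspension_iff {C A C₀ : 𝒯.Obj} {w : C ⟶ 𝒯.T.obj A} {w₀ : C₀ ⟶ A}
    {e : 𝒯.T.obj C₀ ≅ C} (h : 𝒯.T.map w₀ = e.hom ≫ w) (r : ℝ) (hr : 0 ≤ r) :
    IsNull (drift r hr _ ≫ hom (r := 0) w₀) ↔ IsNull (drift r hr _ ≫ hom (r := 0) w) := by
  rw [← isNull_drift_comp_T_iff, h, hom_arrow_comp, ← Category.assoc, ← comp_drift_hom,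
    Category.assoc]
  exact isNull_iso_comp (isoTot e) _

/-- Exactness at `A` of the back-rotated sequence `C₀ → A → B`. It is checked on shift `0` maps
after applying `T`, where it comes from rotating the triangle twice; the sign of `-T u` is absorbed
into the factorization. -/
theorem hom_desc_desuspension {A B C C₀ : 𝒯.Obj} {u : A ⟶ B} {v : B ⟶ C} {w : C ⟶ 𝒯.T.obj A}
    (H : Triangle.mk u v w ∈ distTriang 𝒯.cat.Obj) {w₀ : C₀ ⟶ A}
    {e : 𝒯.T.obj C₀ ≅ C} (h : 𝒯.T.map w₀ = e.hom ≫ w) {X : 𝒯.Obj}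
    (f : 𝒯.cat.tot A ⟶ 𝒯.cat.tot X) (hf : IsNull (hom (r := 0) w₀ ≫ f)) :
    ∃ g : 𝒯.cat.tot B ⟶ 𝒯.cat.tot X, f = hom (r := 0) u ≫ g := by
  refine 𝒯.Sh.exists_desc (u := w₀) (fun {Y} f hf => ?_) f hf
  have h0 : w ≫ 𝒯.T.map f = 0 := by
    rw [← cancel_epi e.hom, ← Category.assoc, ← h, ← Functor.map_comp, hf]
    simp
  obtain ⟨g, hg⟩ : ∃ g : 𝒯.T.obj B ⟶ 𝒯.T.obj Y, 𝒯.T.map f = (-𝒯.T.map u) ≫ g :=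
    Triangle.yoneda_exact₂ _ (rot_of_distTriang _ (rot_of_distTriang _ H)) (𝒯.T.map f) h0
  obtain ⟨g₀, rfl⟩ := 𝒯.T.map_surjective g
  refine ⟨-g₀, 𝒯.T.map_injective ?_⟩
  rw [hg, Functor.map_comp, Functor.map_neg, Preadditive.comp_neg, Preadditive.neg_comp]

/-- If the cone of `u : A ⟶ B` is `r`-acyclic, then `A` and `B` are interleaved. -/
theorem interleaved_of_isAcyclic_cone {A B C : 𝒯.Obj} {u : A ⟶ B} {v : B ⟶ C}
    {w : C ⟶ 𝒯.T.obj A} (H : Triangle.mk u v w ∈ distTriang 𝒯.cat.Obj) {r : ℝ} {hr : 0 ≤ r}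
    (hC : 𝒯.cat.IsAcyclic r hr C) : Interleaved A B (2 * r) := by
  rw [isAcyclic_iff] at hC
  obtain ⟨g, hg⟩ := 𝒯.hom_lift H (drift r hr _) (by
    rw [← comp_drift_hom]
    exact hC.comp_left _)
  obtain ⟨C₀, w₀, e, h⟩ := 𝒯.exists_desuspension w
  obtain ⟨g', hg'⟩ := 𝒯.hom_desc_desuspension H h (drift r hr _) (by
    rw [comp_drift_hom, 𝒯.isNull_desuspension_iff h]
    exact hC.comp _)
  -- `g` is a left and `g'` a right inverse of `u` up to drift, so they agree after one more drift.
  -- That extra drift is why the constant is `2r` and not `r`.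
  have key : drift r hr _ ≫ g = drift r hr _ ≫ g' := by
    conv_rhs => rw [hg, Category.assoc, ← hg']
    rw [comp_drift_hom]
  have hdd : ∀ X : 𝒯.cat.Tot, drift (2 * r) (by positivity) X = drift r hr X ≫ drift r hr X := by
    intro X
    rw [drift_comp_drift]
    congr 1
    ring
  refine ⟨by positivity, hom (r := 0) u, drift r hr _ ≫ g, ?_, ?_⟩
  · rw [key, ← Category.assoc, comp_drift_hom, Category.assoc, ← hg', hdd]
  · rw [Category.assoc, ← hg, hdd]

/-- If `u : A ⟶ B` is invertible up to `r`, then its cone is `2r`-acyclic. -/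
theorem isAcyclic_cone {A B C : 𝒯.Obj} {u : A ⟶ B} {v : B ⟶ C}
    {w : C ⟶ 𝒯.T.obj A} (H : Triangle.mk u v w ∈ distTriang 𝒯.cat.Obj) {r : ℝ} {hr : 0 ≤ r}
    (q : 𝒯.cat.tot B ⟶ 𝒯.cat.tot A) (h1 : hom (r := 0) u ≫ q = drift r hr _)
    (h2 : q ≫ hom (r := 0) u = drift r hr _) :
    𝒯.cat.IsAcyclic (r + r) (add_nonneg hr hr) C := by
  have huv : IsNull (hom (r := 0) u ≫ hom (r := 0) v) := by
    rw [← hom_arrow_comp, isNull_hom_arrow]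
    exact comp_distTriang_mor_zero₁₂ _ H
  -- Since `drift r` on `B` factors through `u`, it is killed by `v`; so `drift r` on `C` factors
  -- through `w`.
  have hv : IsNull (hom (r := 0) v ≫ drift r hr (𝒯.cat.tot C)) := by
    rw [comp_drift_hom, ← h2, Category.assoc]
    exact huv.comp_left _
  obtain ⟨x, hx⟩ : ∃ x : 𝒯.cat.tot (𝒯.T.obj A) ⟶ 𝒯.cat.tot C,
      drift r hr (𝒯.cat.tot C) = hom (r := 0) w ≫ x :=
    𝒯.hom_desc (rot_of_distTriang _ H) _ hv
  obtain ⟨C₀, w₀, e, h⟩ := 𝒯.exists_desuspension w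
  have hw₀ : w₀ ≫ u = 0 := by
    apply 𝒯.T.map_injective
    rw [Functor.map_comp, h, Category.assoc, Functor.map_zero,
      show w ≫ 𝒯.T.map u = 0 from comp_distTriang_mor_zero₃₁ _ H, comp_zero]
  -- Dually, `drift r` on `A` factors through `u`, and `w₀ ≫ u = 0`. The two facts together kill the
  -- double drift on `C`.
  have hw : IsNull (drift r hr _ ≫ hom (r := 0) w) := by
    rw [← 𝒯.isNull_desuspension_iff h, ← comp_drift_hom, ← h1, ← Category.assoc,
      ← hom_arrow_comp]
    exact (isNull_hom_arrow.mpr hw₀).comp _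
  rw [isAcyclic_iff, ← drift_comp_drift hr hr]
  conv => enter [1, 2]; rw [hx]
  rw [← Category.assoc]
  exact hw.comp _

end TPC

namespace TPC

open PersCat

variable {k : Type w} [Field k] (𝒯 : TPC.{w, v, u} k)

/-! ### From cone decompositions to interleavings -/

/-- A strict bound on the infimum yields an actual strict exact triangle of weight `r < ε`. Only its
underlying exact triangle and the `r`-isomorphism onto a shift of `C` are kept. -/
theorem exists_distTriang_of_weight_lt {A B C : 𝒯.Obj} {u : 𝒯.cat.inf A ⟶ 𝒯.cat.inf B}
    {v : 𝒯.cat.inf B ⟶ 𝒯.cat.inf C} {w : 𝒯.cat.inf C ⟶ 𝒯.cat.inf (𝒯.T.obj A)} {ε : ℝ}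
    (h : 𝒯.weight u v w < ENNReal.ofReal ε) :
    ∃ (s q : ℝ) (C' : 𝒯.Obj) (u' : (𝒯.Sh.zero s).obj A ⟶ (𝒯.Sh.zero q).obj B)
      (v' : (𝒯.Sh.zero q).obj B ⟶ C') (w' : C' ⟶ 𝒯.T.obj ((𝒯.Sh.zero s).obj A)),
      Triangle.mk u' v' w' ∈ distTriang 𝒯.cat.Obj ∧ Interleaved C' C (2 * ε) := by
  simp only [weight, unstableWeight, iInf_lt_iff] at h
  obtain ⟨s, _, q, s', r, _, _, _, hr, u', v', w', hst, _, _, _, hlt⟩ := h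
  obtain ⟨C', v'', w'', φ, ψ, hd, ⟨K, a, b, hK, hac⟩, -⟩ := hst
  have hrε : r < ε := (ENNReal.ofReal_lt_ofReal_iff_of_nonneg hr).mp hlt
  exact ⟨s, -q, C', u', v'', w'', hd,
    ((𝒯.interleaved_of_isAcyclic_cone hK hac).trans_iso (𝒯.Sh.toutIso (-s') C)).mono
      (by linarith)⟩

theorem isZero_zero_obj {A : 𝒯.Obj} (hA : IsZero A) (s : ℝ) : IsZero ((𝒯.Sh.zero s).obj A) := by
  rw [IsZero.iff_id_eq_zero]
  have := ((isNull_id_of_isZero hA).comp_left (𝒯.Sh.tout s A)).comp (𝒯.Sh.tinto s A)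
  rw [Category.comp_id, ShiftFunctor.tout_tinto] at this
  exact this

theorem isAcyclic_T {A : 𝒯.Obj} {r : ℝ} {hr : 0 ≤ r} (hA : 𝒯.cat.IsAcyclic r hr A) :
    𝒯.cat.IsAcyclic r hr (𝒯.T.obj A) := by
  have h := 𝒯.isNull_drift_comp_T_iff (𝟙 A) r hr
  rw [CategoryTheory.Functor.map_id, hom_arrow_id, hom_arrow_id, Category.comp_id,
    Category.comp_id] at h
  exact h.mpr hA

theorem isAcyclic_zero_obj {A : 𝒯.Obj} {r : ℝ} {hr : 0 ≤ r} (hA : 𝒯.cat.IsAcyclic r hr A)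
    (s : ℝ) : 𝒯.cat.IsAcyclic r hr ((𝒯.Sh.zero s).obj A) := by
  have := (interleaved_of_iso (𝒯.Sh.toutIso s A).symm le_rfl).isAcyclic hA
  simpa using this

theorem interleaved_of_weight_lt_of_isZero {A B C : 𝒯.Obj} {u : 𝒯.cat.inf A ⟶ 𝒯.cat.inf B}
    {v : 𝒯.cat.inf B ⟶ 𝒯.cat.inf C} {w : 𝒯.cat.inf C ⟶ 𝒯.cat.inf (𝒯.T.obj A)} {ε : ℝ}
    (h : 𝒯.weight u v w < ENNReal.ofReal ε) (hA : IsZero A) : Interleaved B C (2 * ε) := by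
  obtain ⟨s, q, C', u', v', w', hd, hi⟩ := 𝒯.exists_distTriang_of_weight_lt h
  have : IsIso v' :=
    (Triangle.isZero₁_iff_isIso₂ _ hd).mp (𝒯.isZero_zero_obj hA s)
  have := (interleaved_of_iso ((𝒯.Sh.toutIso q B).symm ≪≫ isoTot (asIso v')) le_rfl).trans hi
  rwa [zero_add] at this

/-- After two rotations, the connecting map `C' ⟶ T Σ^s A` has as cone a translate of a shift of
`B`, which is `r`-acyclic. -/
theorem interleaved_of_weight_lt_of_isAcyclic {A B C : 𝒯.Obj}
    {u : 𝒯.cat.inf A ⟶ 𝒯.cat.inf B} {v : 𝒯.cat.inf B ⟶ 𝒯.cat.inf C}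
    {w : 𝒯.cat.inf C ⟶ 𝒯.cat.inf (𝒯.T.obj A)} {ε : ℝ}
    (h : 𝒯.weight u v w < ENNReal.ofReal ε) {r : ℝ} {hr : 0 ≤ r}
    (hB : 𝒯.cat.IsAcyclic r hr B) : Interleaved C (𝒯.T.obj A) (2 * ε + 2 * r) := by
  obtain ⟨s, q, C', u', v', w', hd, hi⟩ := 𝒯.exists_distTriang_of_weight_lt h
  have h1 : Interleaved C' (𝒯.T.obj ((𝒯.Sh.zero s).obj A)) (2 * r) :=
    𝒯.interleaved_of_isAcyclic_cone (rot_of_distTriang _ (rot_of_distTriang _ hd))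
      (𝒯.isAcyclic_T (𝒯.isAcyclic_zero_obj hB q))
  rw [𝒯.T_obj] at h1
  exact hi.symm.trans (h1.trans_iso (𝒯.Sh.toutIso s (𝒯.T.obj A)))

theorem exists_add_eq_of_add_lt_ofReal {a b : ℝ≥0∞} {ε : ℝ} (h : a + b < ENNReal.ofReal ε) :
    ∃ x y : ℝ, a < ENNReal.ofReal x ∧ b < ENNReal.ofReal y ∧ x + y = ε := by
  have hfin : a + b ≠ ⊤ := (h.trans ENNReal.ofReal_lt_top).ne
  rw [ENNReal.add_ne_top] at hfin
  have h' : a.toReal + b.toReal < ε := by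
    rw [← ENNReal.toReal_add hfin.1 hfin.2]
    exact (ENNReal.lt_ofReal_iff_toReal_lt (ENNReal.add_ne_top.mpr hfin)).mp h
  -- The slack is split evenly, so that both inequalities stay strict.
  refine ⟨a.toReal + (ε - a.toReal - b.toReal) / 2, b.toReal + (ε - a.toReal - b.toReal) / 2,
    ?_, ?_, by ring⟩
  · rw [ENNReal.lt_ofReal_iff_toReal_lt hfin.1]
    linarith
  · rw [ENNReal.lt_ofReal_iff_toReal_lt hfin.2]
    linarith

/-- Each cone over a zero object changes the partial cone only by an interleaving of twice the
weight, and the process starts at `0`. -/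
theorem HasConeDecomp.isAcyclic {L : List 𝒯.Obj} {X : 𝒯.Obj} {c : ℝ≥0∞}
    (h : 𝒯.HasConeDecomp L X c) : (∀ A ∈ L, IsZero A) → ∀ ε : ℝ, c < ENNReal.ofReal ε →
      ∃ hε : 0 ≤ 2 * ε, 𝒯.cat.IsAcyclic (2 * ε) hε X := by
  induction h with
  | nil hZ =>
    intro _ ε hε
    have h0 : 0 < ε := ENNReal.ofReal_pos.mp hε
    have h1 : 𝒯.cat.IsAcyclic 0 le_rfl _ := isAcyclic_zero_of_isZero hZ
    exact ⟨by positivity, h1.mono (by positivity)⟩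
  | snoc h u v w _ ih =>
    intro hL ε hε
    obtain ⟨x, y, hx, hy, rfl⟩ := exists_add_eq_of_add_lt_ofReal hε
    obtain ⟨hx0, hac⟩ := ih (fun A hA => hL A (by simp [hA])) x hx
    have hi := 𝒯.interleaved_of_weight_lt_of_isZero hy (hL _ (by simp))
    rw [mul_add]
    exact ⟨_, hi.isAcyclic hac⟩

theorem HasConeDecomp.interleaved {L : List 𝒯.Obj} {X : 𝒯.Obj} {c : ℝ≥0∞}
    (h : 𝒯.HasConeDecomp L X c) : ∀ (L₁ : List 𝒯.Obj) (A : 𝒯.Obj) (L₂ : List 𝒯.Obj),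
      L = L₁ ++ A :: L₂ → (∀ B ∈ L₁, IsZero B) → (∀ B ∈ L₂, IsZero B) →
      ∀ ε : ℝ, c < ENNReal.ofReal ε → Interleaved X (𝒯.T.obj A) (4 * ε) := by
  induction h with
  | nil hZ => intro L₁ A L₂ hL; simp at hL
  | snoc h u v w _ ih =>
    intro L₁ A L₂ hL h₁ h₂ ε hε
    obtain ⟨x, y, hx, hy, rfl⟩ := exists_add_eq_of_add_lt_ofReal hε
    have hy0 : 0 < y := ENNReal.ofReal_pos.mp (bot_le.trans_lt hy)
    -- Either the distinguished object is attached last, to a `2x`-acyclic object, at cost `2y +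
    -- 4x`; or the last step is a cone over zero and adds `2y`. Both fit in `4(x + y)`.
    rcases L₂.eq_nil_or_concat with rfl | ⟨L₃, A', rfl⟩
    · obtain ⟨rfl, hA⟩ := List.append_inj' hL rfl
      obtain rfl : _ = A := by simpa using hA
      obtain ⟨hx0, hac⟩ := HasConeDecomp.isAcyclic 𝒯 h h₁ x hx
      exact (𝒯.interleaved_of_weight_lt_of_isAcyclic hy hac).mono (by linarith)
    · rw [List.concat_eq_append, ← List.cons_append, ← List.append_assoc] at hL
      obtain ⟨rfl, hA⟩ := List.append_inj' hL rfl
      obtain rfl : _ = A' := by simpa using hA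
      have hi := ih L₁ A L₃ rfl h₁ (fun B hB => h₂ B (by simp [hB])) x hx
      have hi' := 𝒯.interleaved_of_weight_lt_of_isZero hy (h₂ _ (by simp))
      exact (hi'.symm.trans hi).mono (by linarith)

theorem interleavingDistHat_le_of_interleaved {X Y : 𝒯.Obj} {t : ℝ}
    (h : Interleaved X Y (2 * t)) : 𝒯.interleavingDistHat X Y ≤ ENNReal.ofReal t := by
  obtain ⟨ht2, f, g, h1, h2⟩ := h
  have ht : 0 ≤ t := by linarith
  have hdeg : deg f + deg g = 2 * t := by rw [← deg_comp, h1, deg_drift]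
  -- The degrees of `f` and `g` add up to `2t`; replacing `X` by `Σ^ρ X` makes both equal to `t`.
  set ρ := deg f - t with hρ
  obtain ⟨φ, hφ⟩ := exists_arrow_eq
    (𝒯.Sh.tout t ((𝒯.Sh.zero ρ).obj X) ≫ 𝒯.Sh.tout ρ X ≫ f) (by simp; linarith)
  obtain ⟨ψ, hψ⟩ := exists_arrow_eq
    (𝒯.Sh.tout t Y ≫ g ≫ 𝒯.Sh.tinto ρ X) (by simp; linarith)
  refine (iInf_le _ ρ).trans ?_
  refine iInf₂_le_of_le t ht (iInf₂_le_of_le φ ψ (iInf₂_le_of_le ?_ ?_ le_rfl))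
  · rw [← hom_eq_iff (r := 0), hom_arrow_comp, hom_arrow_comp, hom_eqToHom,
      ShiftFunctor.hom_zero_map, hψ, ← Category.assoc (𝒯.Sh.tS t _),
      ShiftFunctor.tout_natural, hφ, ShiftFunctor.hom_eta, ShiftFunctor.tout_two_mul]
    simp only [Category.assoc]
    rw [← Category.assoc f, h1, ← comp_drift_hom _ _ (𝒯.Sh.tinto ρ X),
      ShiftFunctor.tout_tinto_assoc]
  · rw [← hom_eq_iff (r := 0), hom_arrow_comp, hom_arrow_comp, hom_eqToHom,
      ShiftFunctor.hom_zero_map, hφ, ← Category.assoc (𝒯.Sh.tS t _),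
      ShiftFunctor.tout_natural, hψ, ShiftFunctor.hom_eta, ShiftFunctor.tout_two_mul]
    simp only [Category.assoc]
    rw [ShiftFunctor.tinto_tout_assoc, h2]

theorem half_interleavingDistHat_le_fragDeltaHat {Z : 𝒯.Obj} (hZ : IsZero Z) (X Y : 𝒯.Obj) :
    (1 / 2 : ℝ≥0∞) * 𝒯.interleavingDistHat X Y ≤ 𝒯.fragDeltaHat {Z} X Y := by
  simp only [fragDeltaHat, fragDelta, le_iInf_iff]
  intro a b L₁ L₂ c h₁ h₂ hc
  refine le_of_forall_gt fun d hd => ?_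
  -- A real `x` above `c` is needed for strict weight bounds. The `4x`-interleaving it yields gives
  -- distance at most `2x`, and this is the source of the factor `1 / 2`.
  obtain ⟨x, hx0, hcx, hxd⟩ := ENNReal.lt_iff_exists_real_btwn.mp hd
  refine lt_of_le_of_lt ?_ hxd
  have hi := HasConeDecomp.interleaved 𝒯 hc L₁ _ L₂ rfl
    (fun B hB => by rw [h₁ B hB]; exact hZ) (fun B hB => by rw [h₂ B hB]; exact hZ) x hcx
  have hi' : Interleaved X Y (4 * x) := ((hi.symm.trans_iso (𝒯.Sh.toutIso a X)).symm.trans_iso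
    (isoTot ((shiftEquiv 𝒯.cat.Obj (1 : ℤ)).counitIso.app _))).trans_iso (𝒯.Sh.toutIso b Y)
  have := 𝒯.interleavingDistHat_le_of_interleaved (X := X) (Y := Y) (t := 2 * x)
    (by convert hi' using 1; ring)
  calc (1 / 2 : ℝ≥0∞) * 𝒯.interleavingDistHat X Y
      ≤ (1 / 2 : ℝ≥0∞) * ENNReal.ofReal (2 * x) := by gcongr
    _ = ENNReal.ofReal x := by
      rw [ENNReal.ofReal_mul zero_le_two, ← mul_assoc, ENNReal.ofReal_ofNat, one_div,
        ENNReal.inv_mul_cancel two_ne_zero ENNReal.ofNat_ne_top, one_mul]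

end TPC

namespace TPC

open PersCat
open scoped ZeroObject

variable {k : Type w} [Field k] (𝒯 : TPC.{w, v, u} k)

/-! ### From interleavings to cone decompositions -/

/-- Needed because exactness in `𝒞_∞` is tested through `Tmap` of a representative of the first
isomorphism, here the identity. -/
theorem hom_Tmap_one (A : 𝒯.Obj) : hom (𝒯.Tmap (𝒯.cat.one A)) = 𝟙 _ := by
  have h0 : 𝒯.cat.compTo (neg_add_cancel 0).le (𝒯.Sh.out 0 A) (𝒯.cat.one A) =
      𝒯.Sh.eta 0 le_rfl A := 𝒯.cat.compTo_one _ _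
  have hd : drift 0 le_rfl (𝒯.cat.tot (𝒯.T.obj A)) = 𝟙 _ := hom_pmap_of_eq _ rfl _
  rw [Tmap, hom_compTo_of_eq _ (add_zero 0), h0, 𝒯.shift_eta, eqToHom_trans_assoc, eqToHom_refl,
    Category.id_comp, ShiftFunctor.hom_eta, hd, Category.comp_id]
  exact 𝒯.Sh.tinto_tout 0 _

/-- The triangle `A → 0 → C → T A` of the limit category attached to an isomorphism `C ≅ T A`. -/
theorem isExactInf_of_iso {A Z C : 𝒯.Obj} (hZ : IsZero Z) (i : 𝒯.cat.inf C ≅ 𝒯.cat.inf (𝒯.T.obj A))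
    (u : 𝒯.cat.inf A ⟶ 𝒯.cat.inf Z) (v : 𝒯.cat.inf Z ⟶ 𝒯.cat.inf C) :
    𝒯.IsExactInf u v i.hom := by
  refine ⟨A, 0, 𝒯.T.obj A, 0, 0, 𝟙 _, 0, 𝒯.cat.one A,
    𝒯.cat.cls (r := 0) (0 : (0 : 𝒯.Obj) ⟶ Z), i.inv,
    contractible_distinguished₂ A, ?_, ?_, inferInstance,
    inf_hom_eq_of_isZero_tgt hZ _ _, inf_hom_eq_of_isZero_src (isZero_zero _) _ _, ?_⟩
  · exact inferInstanceAs (IsIso (𝟙 (𝒯.cat.inf A)))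
  · exact ⟨𝒯.cat.cls (r := 0) (0 : Z ⟶ (0 : 𝒯.Obj)),
      inf_hom_eq_of_isZero_src (isZero_zero _) _ _, inf_hom_eq_of_isZero_src hZ _ _⟩
  · rw [← toInf_hom (𝒯.Tmap _), hom_Tmap_one, i.inv_hom_id]
    exact Category.id_comp (𝟙 _)

/-- An exact triangle `A → 0 → C → TA` of `𝒞_∞` whose third map has an inverse `p` of shift `0` with
`r`-acyclic cone is represented by a strict exact triangle of weight `r`. -/
theorem weight_le_of_isAcyclic_cone {A Z C K : 𝒯.Obj} (hZ : IsZero Z) {p : 𝒯.T.obj A ⟶ C}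
    {a : C ⟶ K} {b : K ⟶ 𝒯.T.obj (𝒯.T.obj A)} (hd : Triangle.mk p a b ∈ distTriang 𝒯.cat.Obj)
    {r : ℝ} {hr : 0 ≤ r} (hK : 𝒯.cat.IsAcyclic r hr K)
    (W : 𝒯.cat.tot C ⟶ 𝒯.cat.tot (𝒯.T.obj A)) (hdeg : deg W = r)
    (hW : W ≫ hom (r := 0) p = drift r hr _)
    (u : 𝒯.cat.inf A ⟶ 𝒯.cat.inf Z) (v : 𝒯.cat.inf Z ⟶ 𝒯.cat.inf C) :
    𝒯.weight u v (toInf W) ≤ ENNReal.ofReal r := by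
  have hA₁ : 𝒯.T.obj ((𝒯.Sh.zero 0).obj A) = 𝒯.T.obj A := by rw [𝒯.Sh.zero_obj_zero]
  have hC₁ : C = (𝒯.Sh.zero (-0)).obj C := by rw [neg_zero, 𝒯.Sh.zero_obj_zero]
  have hC₂ : eqToHom (congrArg 𝒯.cat.tot hC₁) = 𝒯.Sh.tinto (-0) C := by
    have : ∀ x (hx : x = 0), eqToHom (congrArg 𝒯.cat.tot
        (show C = (𝒯.Sh.zero x).obj C by rw [hx, 𝒯.Sh.zero_obj_zero])) = 𝒯.Sh.tinto x C := by
      rintro _ rfl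
      have := 𝒯.Sh.tinto_tout 0 C
      rw [ShiftFunctor.tout_zero] at this
      rw [← Category.comp_id (𝒯.Sh.tinto 0 C)]
      have h := congrArg (fun f => f ≫ eqToHom (congrArg 𝒯.cat.tot (𝒯.Sh.zero_obj_zero C).symm))
        this
      simpa using h.symm
    exact this _ neg_zero
  -- `w'` and `ψ` are both `W` brought to shift `0`: the first by moving the target to `Σ^{-r}`, the
  -- second by moving the source to `Σ^r`. This makes `ψ ≫ w` match `Σ^r w'`, and `W ≫ p = drift r`
  -- gives `ψ ≫ φ = η_r`.
  obtain ⟨w', hw'⟩ := exists_arrow_eq (𝒯.Sh.tout (-0) C ≫ W ≫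
    eqToHom (congrArg 𝒯.cat.tot hA₁.symm) ≫ 𝒯.Sh.tinto (-r) _) (by simp [hdeg])
  obtain ⟨ψ, hψ⟩ := exists_arrow_eq (𝒯.Sh.tout r _ ≫ 𝒯.Sh.tout (-0) C ≫ W ≫
    eqToHom (congrArg 𝒯.cat.tot hA₁.symm)) (by simp [hdeg])
  have hZ' : IsZero ((𝒯.Sh.zero (-0)).obj Z) := 𝒯.isZero_zero_obj hZ _
  refine iInf₂_le_of_le 0 le_rfl (iInf_le_of_le 0 (iInf₂_le_of_le 0 r (iInf₂_le_of_le le_rfl le_rfl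
    (iInf₂_le_of_le hr hr (iInf₂_le_of_le 0 0 (iInf₂_le_of_le w' ?_ (iInf₂_le_of_le ?_ ?_
    (iInf_le_of_le ?_ le_rfl))))))))
  -- The underlying exact triangle is `A → 0 → TA = TA`, and the `r`-isomorphism is `p`, up to the
  -- identifications `Σ^0 A = A` and `Σ^{-0} C = C`.
  · refine ⟨_, 0, 𝟙 _, eqToHom hA₁ ≫ p ≫ eqToHom hC₁, ψ, ?_, ⟨K, eqToHom hC₁.symm ≫ a,
      b ≫ 𝒯.T.map (eqToHom hA₁.symm), ?_, hK⟩, ?_, ?_, ?_⟩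
    · refine isomorphic_distinguished _ (contractible_distinguished₂ _) _
        (Triangle.isoMk _ _ (Iso.refl _) (hZ'.iso (isZero_zero _)) (Iso.refl _) ?_ ?_ ?_)
      · exact (isZero_zero _).eq_of_tgt _ _
      · exact hZ'.eq_of_src _ _
      · exact (Category.id_comp _).trans
          ((𝒯.T.map_id _).trans (Category.id_comp (𝟙 (𝒯.T.obj _))).symm)
    · refine isomorphic_distinguished _ hd _
        (Triangle.isoMk _ _ (eqToIso hA₁) (eqToIso hC₁.symm) (Iso.refl _) ?_ ?_ ?_)
      · change (eqToHom hA₁ ≫ p ≫ eqToHom hC₁) ≫ eqToHom hC₁.symm = eqToHom hA₁ ≫ p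
        simp
      · change (eqToHom hC₁.symm ≫ a) ≫ 𝟙 K = eqToHom hC₁.symm ≫ a
        simp
      · change (b ≫ 𝒯.T.map (eqToHom hA₁.symm)) ≫ 𝒯.T.map (eqToHom hA₁) = 𝟙 K ≫ b
        rw [Category.assoc, ← 𝒯.T.map_comp, eqToHom_trans, eqToHom_refl, 𝒯.T.map_id,
          Category.comp_id, Category.id_comp]
    · rw [← hom_eq_iff (r := 0), hom_arrow_comp, hψ, hom_arrow_comp, hom_arrow_comp, hom_eqToHom,
        hom_eqToHom, ShiftFunctor.hom_eta]
      simp only [Category.assoc]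
      rw [eqToHom_trans_assoc, eqToHom_refl, Category.id_comp, ← Category.assoc W, hW, hC₂,
        ← comp_drift_hom, ShiftFunctor.tout_tinto_assoc]
    · rw [zero_comp]
    · rw [Category.comp_id, ← hom_eq_iff (r := 0), hψ, hom_arrow_comp, hom_eqToHom,
        ← ShiftFunctor.tout_tout_neg, ShiftFunctor.hom_zero_map,
        ← Category.assoc (𝒯.Sh.tS r _), ShiftFunctor.tout_natural, hw']
      simp only [Category.assoc, ShiftFunctor.tinto_tout, Category.comp_id]
  · exact inf_hom_eq_of_isZero_tgt hZ _ _
  · exact inf_hom_eq_of_isZero_src hZ _ _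
  · have h := congrArg toInf (show 𝒯.Sh.tinto (-0) C ≫ hom (r := 0) w' ≫
      𝒯.Sh.tout (-r) _ = W ≫ 𝒯.Sh.tinto 0 (𝒯.T.obj A) ≫
        hom (r := 0) (eqToHom (𝒯.T_obj 0 A).symm) by
      have h0 : 𝒯.Sh.tinto 0 (𝒯.T.obj A) =
          eqToHom (congrArg 𝒯.cat.tot (𝒯.Sh.zero_obj_zero _).symm) := by
        rw [ShiftFunctor.tinto_eq, ShiftFunctor.hom_η_self, Category.comp_id]
      rw [hw', h0, hom_eqToHom, eqToHom_trans]
      simp)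
    exact h

theorem fragDelta_le_of_inverse {X Y : 𝒯.Obj} {p : X ⟶ Y} {r : ℝ} {hr : 0 ≤ r}
    (q : 𝒯.cat.tot Y ⟶ 𝒯.cat.tot X) (h1 : hom (r := 0) p ≫ q = drift r hr _)
    (h2 : q ≫ hom (r := 0) p = drift r hr _) (F : Set 𝒯.Obj) :
    𝒯.fragDelta F Y X ≤ ENNReal.ofReal (r + r) := by
  let A : 𝒯.Obj := 𝒯.Tinv.obj X
  let j : 𝒯.T.obj A ≅ X := (shiftEquiv 𝒯.cat.Obj (1 : ℤ)).counitIso.app X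
  have hdeg : deg q = r := by simpa using congrArg deg h2
  have hj : hom (r := 0) j.hom ≫ hom (r := 0) j.inv = 𝟙 _ := (isoTot j).hom_inv_id
  have hj' : hom (r := 0) j.inv ≫ hom (r := 0) j.hom = 𝟙 _ := (isoTot j).inv_hom_id
  set p' : 𝒯.T.obj A ⟶ Y := j.hom ≫ p with hp'
  set q' : 𝒯.cat.tot Y ⟶ 𝒯.cat.tot (𝒯.T.obj A) := q ≫ hom (r := 0) j.inv with hq'
  have h1' : hom (r := 0) p' ≫ q' = drift r hr _ := by
    rw [hp', hom_arrow_comp, Category.assoc, ← Category.assoc (hom _) q, h1, ← comp_drift_hom,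
      ← Category.assoc, hj, Category.id_comp]
  have h2' : q' ≫ hom (r := 0) p' = drift r hr _ := by
    rw [hp', hom_arrow_comp, Category.assoc, ← Category.assoc (hom (r := 0) j.inv), hj',
      Category.id_comp, h2]
  -- The cone of `p'` is only known to be `2r`-acyclic, so the inverse is drifted once more to have
  -- shift `2r` as well.
  set W := q' ≫ drift r hr _ with hWdef
  have hW : W ≫ hom (r := 0) p' = drift (r + r) (add_nonneg hr hr) _ := by
    rw [hWdef, Category.assoc, ← comp_drift_hom, ← Category.assoc, h2', drift_comp_drift]
  have hW' : hom (r := 0) p' ≫ W = drift (r + r) (add_nonneg hr hr) _ := by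
    rw [hWdef, ← Category.assoc, h1', drift_comp_drift]
  have hWdeg : deg W = r + r := by simp [hWdef, hq', hdeg]
  obtain ⟨K, a, b, hd⟩ := distinguished_cocone_triangle p'
  let i : 𝒯.cat.inf Y ≅ 𝒯.cat.inf (𝒯.T.obj A) :=
    { hom := toInf W
      inv := toInf (hom (r := 0) p')
      hom_inv_id := by rw [← toInf_comp, hW, toInf_drift]
      inv_hom_id := by rw [← toInf_comp, hW', toInf_drift] }
  let u : 𝒯.cat.inf A ⟶ 𝒯.cat.inf (0 : 𝒯.Obj) := 𝒯.cat.cls (r := 0) (0 : A ⟶ 0)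
  let v : 𝒯.cat.inf (0 : 𝒯.Obj) ⟶ 𝒯.cat.inf Y := 𝒯.cat.cls (r := 0) (0 : 0 ⟶ Y)
  have hc := HasConeDecomp.snoc (HasConeDecomp.nil (𝒯 := 𝒯) (isZero_zero 𝒯.Obj)) u v i.hom
    (𝒯.isExactInf_of_iso (isZero_zero _) i u v)
  refine iInf₂_le_of_le [] [] (iInf₂_le_of_le _ (by simp) (iInf₂_le_of_le (by simp) hc ?_))
  rw [zero_add]
  exact 𝒯.weight_le_of_isAcyclic_cone (isZero_zero _) hd
    (𝒯.isAcyclic_cone hd q' h1' h2') W hWdeg hW u v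

theorem fragDelta_le_of_interleaving {X Y : 𝒯.Obj} {t : ℝ} (ht : 0 ≤ t)
    (φ : (𝒯.Sh.zero t).obj X ⟶ Y) (ψ : (𝒯.Sh.zero t).obj Y ⟶ X)
    (h1 : eqToHom (𝒯.Sh.zero_obj_two_mul t X) ≫ (𝒯.Sh.zero t).map φ ≫ ψ =
      𝒯.Sh.eta (2 * t) (mul_nonneg zero_le_two ht) X)
    (h2 : eqToHom (𝒯.Sh.zero_obj_two_mul t Y) ≫ (𝒯.Sh.zero t).map ψ ≫ φ =
      𝒯.Sh.eta (2 * t) (mul_nonneg zero_le_two ht) Y) (F : Set 𝒯.Obj) :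
    𝒯.fragDelta F Y ((𝒯.Sh.zero t).obj X) ≤ 4 * ENNReal.ofReal t := by
  have aux : ∀ {A B : 𝒯.Obj} (f : (𝒯.Sh.zero t).obj A ⟶ B) (g : (𝒯.Sh.zero t).obj B ⟶ A),
      eqToHom (𝒯.Sh.zero_obj_two_mul t A) ≫ (𝒯.Sh.zero t).map f ≫ g =
        𝒯.Sh.eta (2 * t) (mul_nonneg zero_le_two ht) A →
      𝒯.Sh.tS t (hom (r := 0) f) ≫ hom (r := 0) g = 𝒯.Sh.tout t _ ≫ 𝒯.Sh.tout t A ≫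
        drift (2 * t) (mul_nonneg zero_le_two ht) _ := by
    intro A B f g h
    rw [← hom_eq_iff (r := 0), hom_arrow_comp, hom_arrow_comp, hom_eqToHom,
      ShiftFunctor.hom_zero_map, ShiftFunctor.hom_eta, ShiftFunctor.tout_two_mul,
      Category.assoc, Category.assoc] at h
    exact (cancel_epi _).mp h
  have e1 := aux φ ψ h1
  have e2 := aux ψ φ h2
  -- The inverse of `φ` is `ψ` with both ends unshifted by `tinto`, hence of shift `2t`.
  have key := 𝒯.fragDelta_le_of_inverse (p := φ)
    (𝒯.Sh.tinto t Y ≫ hom (r := 0) ψ ≫ 𝒯.Sh.tinto t X)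
    (r := 2 * t) (hr := mul_nonneg zero_le_two ht) (by
      rw [← Category.assoc, ShiftFunctor.tinto_natural, Category.assoc,
        ← Category.assoc (𝒯.Sh.tS t _), e1]
      simp only [Category.assoc, ShiftFunctor.tinto_tout_assoc]
      rw [← comp_drift_hom, ShiftFunctor.tout_tinto_assoc]) (by
      rw [ShiftFunctor.tinto_natural, Category.assoc, Category.assoc, e2]
      simp only [ShiftFunctor.tinto_tout_assoc]) F
  refine key.trans_eq ?_
  rw [show 2 * t + 2 * t = 4 * t by ring, ENNReal.ofReal_mul (by norm_num), ENNReal.ofReal_ofNat]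

theorem fragDistHat_le (F : Set 𝒯.Obj) (X Y : 𝒯.Obj) :
    𝒯.fragDistHat F X Y ≤ 4 * 𝒯.interleavingDistHat X Y := by
  simp only [interleavingDistHat, interleavingDist, ENNReal.mul_iInf_of_ne four_ne_zero
    ENNReal.ofNat_ne_top, le_iInf_iff]
  intro ρ t ht φ ψ h1 h2
  refine max_le ?_ ?_
  -- `ψ : Σ^t Y ⟶ Σ^ρ X` bounds one direction and `φ : Σ^t Σ^ρ X ⟶ Y` the other, the latter with
  -- shifts `0` and `t + ρ`.
  · exact iInf₂_le_of_le ρ t (𝒯.fragDelta_le_of_interleaving ht ψ φ h2 h1 F)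
  · refine iInf₂_le_of_le 0 (t + ρ) ?_
    rw [𝒯.Sh.zero_obj_zero, 𝒯.Sh.zero_obj_add]
    exact 𝒯.fragDelta_le_of_interleaving ht φ ψ h1 h2 F

end TPC

theorem mainTheorem7 {k : Type w} [Field k] (𝒯 : TPC.{w, v, u} k) :
    (∀ Z : 𝒯.Obj, IsZero Z → ∀ X Y : 𝒯.Obj,
      (1 / 2 : ℝ≥0∞) * 𝒯.interleavingDistHat X Y ≤ 𝒯.fragDistHat {Z} X Y ∧
      𝒯.fragDistHat {Z} X Y ≤ 4 * 𝒯.interleavingDistHat X Y) ∧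
    (∀ F : Set 𝒯.Obj, (∃ Z ∈ F, IsZero Z) → ∀ X Y : 𝒯.Obj,
      𝒯.fragDistHat F X Y ≤ 4 * 𝒯.interleavingDistHat X Y) :=
  ⟨fun _ hZ X Y => ⟨(𝒯.half_interleavingDistHat_le_fragDeltaHat hZ X Y).trans (le_max_left _ _),
    𝒯.fragDistHat_le _ X Y⟩, fun F _ X Y => 𝒯.fragDistHat_le F X Y⟩
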